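/- Let $X$ be a real reflexive separable Banach space with dual $X^*$, let $m\ge 1$, and let $\xi\sim\mathcal N(0,R)$ be an $m$-dimensional Gaussian random vector, where $R$ is a positive definite correlation matrix (unit diagonal). Let $L\in\mathbb R^{m\times m}$ satisfy $R=LL^T$, let $\|z\|$ be the Euclidean norm on $\mathbb R^m$, and $\|L\|$ the corresponding operator norm. Let $g:X\times\mathbb R^m\to\mathbb R$ be locally Lipschitzian jointly in both arguments and convex in the second argument. Put $$\varphi(x):=\mathbb P(g(x,\xi)\le 0),\qquad e(x,v):=\mu_\eta(\{r\ge 0 : g(x,rLv)\le 0\})\quad (x\in X,\ v\in\mathbb S^{m-1}),$$ where $\mu_\eta$ is the Chi-distribution with $m$ degrees of freedom, and let $\mu_\zeta$ be the uniform distribution on the Euclidean unit sphere $\mathbb S^{m-1}\subset\mathbb R^m$. For $f:X\to\mathbb R$ let $$f^\circ(x;h):=\limsup_{y\to x,\ t\downarrow 0}\frac{f(y+th)-f(y)}{t},\qquad \partial^C f(x):=\{x^*\in X^* : \langle x^*,h\rangle\le f^\circ(x;h)\ \ \forall h\in X\}$$ denote Clarke's directional derivative and Clarke's subdifferential, the latter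 being used at points near which $f$ is Lipschitzian, and let $\partial^C_x e(x,v):=\partial^C\big(e(\cdot,v)\big)(x)$. For $x\in X$ and $l>0$ let $$C_l(x):=\Big\{h\in X : g(\cdot,z)^\circ(y;h)\le l\,\|z\|^{-m}e^{\|z\|^2/(2\|L\|^2)}\,\|h\|\ \text{ whenever } \|y-x\|\le 1/l,\ \|z\|\ge l\Big\}.$$ Theorem. Let $x\in X$ satisfy $g(x,0)<0$, and assume that either the set $\{z\in\mathbb R^m : g(x,z)\le 0\}$ is bounded, or $C_l(x)=X$ for some $l>0$. Then $\varphi$ is Lipschitz continuous on a neighbourhood of $x$, and $$\partial^C\varphi(x)\subseteq\int_{\mathbb S^{m-1}}\partial^C_x e(x,v)\,d\mu_\zeta(v),$$ where the right-hand side is the Aumann integral, i.e. the set of all Bochner integrals $\int_{\mathbb S^{m-1}} s(v)\,d\mu_\zeta(v)$ of $\mu_\zeta$-integrable maps $s:\mathbb S^{m-1}\to X^*$ with $s(v)\in\partial^C_x e(x,v)$ for all $v\in\mathbb S^{m-1}$. -/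

import Mathlib

open MeasureTheory Filter Topology

/-- A real Banach space is reflexive if the canonical embedding into its bidual is onto. -/
def ReflexiveSpace (X : Type*) [NormedAddCommGroup X] [NormedSpace ℝ X] : Prop :=
  Function.Surjective (NormedSpace.inclusionInDoubleDual ℝ X)

section Clarke

variable {X : Type*} [NormedAddCommGroup X] [NormedSpace ℝ X]

/-- Clarke's directional derivative
`f°(x; h) = limsup_{y → x, t ↓ 0} (f (y + t h) - f y) / t`, as an extended real number
(it is finite when `f` is Lipschitz near `x`). -/
noncomputable def clarkeDeriv (f : X → ℝ) (x h : X) : EReal :=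
  limsup (fun p : X × ℝ => (((f (p.1 + p.2 • h) - f p.1) / p.2 : ℝ) : EReal))
    (𝓝 x ×ˢ 𝓝[>] (0 : ℝ))

/-- Clarke's subdifferential of a function that is Lipschitz near `x`:
all `x*` in the dual with `⟨x*, h⟩ ≤ f°(x; h)` for every `h`. -/
def clarkeSubdiff (f : X → ℝ) (x : X) : Set (StrongDual ℝ X) :=
  {xs | ∀ h : X, ((xs h : ℝ) : EReal) ≤ clarkeDeriv f x h}

end Clarke

/-- The Aumann integral of a multifunction: the set of Bochner integrals of its integrable
selections. -/
def aumannIntegral {S Y : Type*} [MeasurableSpace S] [NormedAddCommGroup Y] [NormedSpace ℝ Y]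
    (μ : Measure S) (Γ : S → Set Y) : Set Y :=
  {y | ∃ s : S → Y, Integrable s μ ∧ (∀ v, s v ∈ Γ v) ∧ y = ∫ v, s v ∂μ}

/-- The unit sphere of Euclidean `m`-space. -/
abbrev UnitSphere (m : ℕ) : Type :=
  Metric.sphere (0 : EuclideanSpace ℝ (Fin m)) 1

/-- The uniform distribution on the unit sphere (`1 ≤ m`): normalized surface measure. -/
noncomputable def sphereUniform (m : ℕ) : Measure (UnitSphere m) :=
  ((volume : Measure (EuclideanSpace ℝ (Fin m))).toSphere Set.univ)⁻¹ •
    (volume : Measure (EuclideanSpace ℝ (Fin m))).toSphere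

/-- The density of the Chi-distribution with `m` degrees of freedom (`1 ≤ m`, `0 ≤ t`). -/
noncomputable def chiDensity (m : ℕ) (t : ℝ) : ℝ :=
  (2 : ℝ) ^ (1 - (m : ℝ) / 2) / Real.Gamma ((m : ℝ) / 2) * t ^ (m - 1) * Real.exp (-t ^ 2 / 2)

/-- The Chi-distribution with `m` degrees of freedom (`1 ≤ m`), a measure on the half-line. -/
noncomputable def chiMeasure (m : ℕ) : Measure ℝ :=
  ((volume : Measure ℝ).restrict (Set.Ici 0)).withDensity
    (fun t => ENNReal.ofReal (chiDensity m t))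

/-- The operator `v ↦ L v` on Euclidean space; its norm is the spectral norm of `L`. -/
noncomputable abbrev euclOp {m : ℕ} (L : Matrix (Fin m) (Fin m) ℝ) :
    EuclideanSpace ℝ (Fin m) →L[ℝ] EuclideanSpace ℝ (Fin m) :=
  Matrix.toEuclideanCLM (𝕜 := ℝ) L

/-- A nonsingular correlation matrix: positive definite (hence symmetric) with unit diagonal. -/
structure IsCorrelationMatrix {m : ℕ} (R : Matrix (Fin m) (Fin m) ℝ) : Prop where
  posDef : R.PosDef
  diag_eq_one : ∀ i, R i i = 1

section ProbabilityFunction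

variable {X : Type*} {m : ℕ}

/-- The probability function `φ(x) = P(g(x, ξ) ≤ 0)`. -/
noncomputable def probFun {Ω : Type*} [MeasurableSpace Ω] (P : Measure Ω)
    (ξ : Ω → EuclideanSpace ℝ (Fin m)) (g : X → EuclideanSpace ℝ (Fin m) → ℝ) (x : X) : ℝ :=
  (P {ω | g x (ξ ω) ≤ 0}).toReal

/-- The radial probability function `e(x, v) = μ_η {r ≥ 0 | g(x, r L v) ≤ 0}`. -/
noncomputable def radialProb (g : X → EuclideanSpace ℝ (Fin m) → ℝ)
    (L : Matrix (Fin m) (Fin m) ℝ) (x : X) (v : UnitSphere m) : ℝ :=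
  (chiMeasure m
    {r : ℝ | 0 ≤ r ∧ g x (r • euclOp L (v : EuclideanSpace ℝ (Fin m))) ≤ 0}).toReal

/-- The `l`-cone `C_l(x)` of nice directions at `x`. -/
def niceCone [NormedAddCommGroup X] [NormedSpace ℝ X] (g : X → EuclideanSpace ℝ (Fin m) → ℝ)
    (L : Matrix (Fin m) (Fin m) ℝ) (l : ℝ) (x : X) : Set X :=
  {h | ∀ y ∈ Metric.closedBall x (1 / l), ∀ z : EuclideanSpace ℝ (Fin m), l ≤ ‖z‖ →
    clarkeDeriv (fun x' => g x' z) y h ≤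
      ((l * (‖z‖ ^ m)⁻¹ * Real.exp (‖z‖ ^ 2 / (2 * ‖euclOp L‖ ^ 2)) * ‖h‖ : ℝ) : EReal)}

end ProbabilityFunction

/-! The spherical-radial decomposition writes `φ(x)` as the integral of `e(x, v)` over the sphere: a
standard Gaussian vector has a uniform direction and an independent Chi-distributed radius, and `ξ`
has the law of its image under `L`. The theorem then follows from Clarke's theorem on integral
functionals, once the functions `e(·, v)` are Lipschitz near `x` with one constant for all `v`.

The uniform constant comes from one-dimensional convexity (`exists_chiMeasure_sublevel_le`). Along a
ray, `G₁` and `G₂` denote the restrictions of `g` at two nearby points; both are convex and at most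
`-c < 0` at the origin. If `G₁(ρ) = 0` and `r > ρ` satisfies `G₂(r) ≤ 0`, convexity gives `c (r - ρ)
≤ ρ (G₁(r) - G₂(r))`. For small radii the right side is controlled by local Lipschitz continuity on
a compact set. For large radii the permitted growth `r^(-m) exp(r²/2)` is cancelled by the
Chi-density up to a factor `1/r`, which absorbs `ρ`. So the Chi-mass gained between the two sublevel
sets is at most a constant times the distance of the points, wherever `ρ` lies. A bounded sublevel
set at `x` stays bounded nearby, so large radii do not occur in that case.

For Clarke's theorem, Fatou-type domination bounds `φ°(x; h)` by the integral of `e(·, v)°(x; h)`,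
so a subgradient of `φ` is dominated by an integral of sublinear functions. Strassen's
disintegration (`exists_integral_eq_of_le_integral_sublinear`), that is Hahn-Banach on simple
functions followed by Radon-Nikodym, splits it into subgradients of the `e(·, v)`. Reflexivity makes
the dual separable, which turns weak-star measurability of the selection into Bochner measurability.
-/

/-! ### Separability of duals, measurability and densities -/

/-- A normed space with separable dual is separable. -/
theorem separableSpace_of_separableSpace_dual (Y : Type*) [NormedAddCommGroup Y]
    [NormedSpace ℝ Y] [TopologicalSpace.SeparableSpace (StrongDual ℝ Y)] :
    TopologicalSpace.SeparableSpace Y := by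
  set f : ℕ → StrongDual ℝ Y := TopologicalSpace.denseSeq (StrongDual ℝ Y) with hf
  have hy : ∀ n, ∃ y : Y, ‖y‖ ≤ 1 ∧ ‖f n‖ / 2 ≤ ‖f n y‖ := by
    intro n
    rcases eq_or_ne (f n) 0 with h0 | h0
    · exact ⟨0, by simp, by simp [h0]⟩
    · obtain ⟨y, hy1, hy2⟩ := (f n).exists_lt_apply_of_lt_opNorm
        (half_lt_self (norm_pos_iff.2 h0))
      exact ⟨y, hy1.le, hy2.le⟩
  choose y hy1 hy2 using hy
  set p : Submodule ℝ Y := (Submodule.span ℝ (Set.range y)).topologicalClosure with hp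
  have hsub : Submodule.span ℝ (Set.range y) ≤ p := Submodule.le_topologicalClosure _
  have hpt : ∀ x : Y, x ∈ p := by
    intro x
    by_contra hx
    obtain ⟨F, u, hFu, hF⟩ := geometric_hahn_banach_point_closed (p.convex)
      (Submodule.isClosed_topologicalClosure _) hx
    have hF0 : ∀ z ∈ p, F z = 0 := by
      intro z hz
      by_contra hne
      -- On this multiple of `z` the functional takes the value `u - 1`, below its lower bound `u`
      -- on the subspace.
      have h1 := hF (((u - 1) / F z) • z) (p.smul_mem _ hz)
      rw [map_smul, smul_eq_mul, div_mul_cancel₀ _ hne] at h1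
      linarith
    have hF1 : F ≠ 0 := by
      rintro rfl
      have := hF 0 p.zero_mem
      simp at this hFu
      linarith
    have hpos : 0 < ‖F‖ := norm_pos_iff.2 hF1
    -- Since `F` kills `y n`, `‖f n‖ / 2 ≤ ‖F - f n‖`. With distance below `‖F‖ / 4` this forces
    -- `‖F‖ < 3‖F‖ / 4`.
    obtain ⟨n, hn⟩ := (TopologicalSpace.denseRange_denseSeq (StrongDual ℝ Y)).exists_dist_lt F
      (show 0 < ‖F‖ / 4 by positivity)
    have hn' : ‖F - f n‖ < ‖F‖ / 4 := by rwa [dist_eq_norm] at hn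
    have h2 : F (y n) = 0 := hF0 _ (hsub (Submodule.subset_span ⟨n, rfl⟩))
    have h3 : ‖f n (y n)‖ ≤ ‖F - f n‖ := by
      have : ‖(F - f n) (y n)‖ ≤ ‖F - f n‖ := (F - f n).unit_le_opNorm _ (hy1 n)
      simpa [h2] using this
    have h4 : ‖F‖ ≤ ‖F - f n‖ + ‖f n‖ := by
      simpa using norm_add_le (F - f n) (f n)
    have := hy2 n
    linarith
  have hsep : TopologicalSpace.IsSeparable (p : Set Y) :=
    ((Set.countable_range y).isSeparable.span (R := ℝ)).closure
  have : (p : Set Y) = Set.univ := Set.eq_univ_of_forall hpt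
  rw [this] at hsep
  exact TopologicalSpace.isSeparable_univ_iff.1 hsep

/-- The dual of a separable reflexive space is separable. -/
theorem ReflexiveSpace.separableSpace_dual {X : Type*} [NormedAddCommGroup X] [NormedSpace ℝ X]
    [TopologicalSpace.SeparableSpace X] (hX : ReflexiveSpace X) :
    TopologicalSpace.SeparableSpace (StrongDual ℝ X) := by
  have : TopologicalSpace.SeparableSpace (StrongDual ℝ (StrongDual ℝ X)) :=
    hX.denseRange.separableSpace (NormedSpace.inclusionInDoubleDual ℝ X).continuous
  exact separableSpace_of_separableSpace_dual _

/-- Weak-star measurable maps into a separable dual are strongly measurable. -/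
theorem stronglyMeasurable_of_measurable_apply {S X : Type*} [MeasurableSpace S]
    [NormedAddCommGroup X] [NormedSpace ℝ X] [TopologicalSpace.SeparableSpace X]
    [TopologicalSpace.SeparableSpace (StrongDual ℝ X)] {s : S → StrongDual ℝ X}
    (hs : ∀ h, Measurable fun v => s v h) : StronglyMeasurable s := by
  borelize (StrongDual ℝ X)
  set u : ℕ → X := TopologicalSpace.denseSeq X
  set c : ℕ → StrongDual ℝ X := TopologicalSpace.denseSeq (StrongDual ℝ X)
  have hball : ∀ (ξ : StrongDual ℝ X) (r : ℝ), 0 ≤ r →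
      MeasurableSet (s ⁻¹' Metric.closedBall ξ r) := by
    intro ξ r hr
    -- The dual norm is tested on a dense sequence, which leaves countably many measurable
    -- conditions.
    have : s ⁻¹' Metric.closedBall ξ r = ⋂ n, {v | |s v (u n) - ξ (u n)| ≤ r * ‖u n‖} := by
      ext v
      simp only [Set.mem_preimage, Metric.mem_closedBall, dist_eq_norm, Set.mem_iInter,
        Set.mem_ofPred_eq]
      constructor
      · intro h n
        exact (s v - ξ).le_of_opNorm_le h (u n)
      · intro h
        refine ContinuousLinearMap.opNorm_le_bound _ hr fun x => ?_
        refine (TopologicalSpace.denseRange_denseSeq X).induction_on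
          (p := fun x => ‖(s v - ξ) x‖ ≤ r * ‖x‖) x ?_ (fun n => h n)
        exact isClosed_le (by fun_prop) (by fun_prop)
    rw [this]
    exact MeasurableSet.iInter fun n =>
      measurableSet_le (((hs _).sub_const _).abs) measurable_const
  refine stronglyMeasurable_iff_measurable_separable.2
    ⟨measurable_of_isOpen fun U hU => ?_, TopologicalSpace.IsSeparable.of_separableSpace _⟩
  have : s ⁻¹' U = ⋃ (n : ℕ) (k : ℕ) (_ : Metric.closedBall (c n) (1 / ((k : ℝ) + 1)) ⊆ U),
      s ⁻¹' Metric.closedBall (c n) (1 / ((k : ℝ) + 1)) := by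
    ext v
    simp only [Set.mem_preimage, Set.mem_iUnion, exists_prop]
    constructor
    · intro hv
      obtain ⟨ε, hε, hεU⟩ := Metric.isOpen_iff.1 hU _ hv
      obtain ⟨k, hk⟩ := exists_nat_one_div_lt (half_pos hε)
      obtain ⟨n, hn⟩ := (TopologicalSpace.denseRange_denseSeq (StrongDual ℝ X)).exists_dist_lt (s v)
        (show (0 : ℝ) < 1 / ((k : ℝ) + 1) by positivity)
      refine ⟨n, k, fun z hz => hεU ?_, hn.le⟩
      rw [Metric.mem_ball]
      have h1 := Metric.mem_closedBall.1 hz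
      have h2 := dist_triangle z (c n) (s v)
      rw [dist_comm (c n)] at h2
      linarith
    · rintro ⟨n, k, hsub, hv⟩
      exact hsub hv
  rw [this]
  exact MeasurableSet.iUnion fun n => MeasurableSet.iUnion fun k => MeasurableSet.iUnion fun _ =>
    hball _ _ (by positivity)

/-- A finitely additive set function dominated by a finite measure has a density. -/
theorem exists_density_of_abs_le {S : Type*} [MeasurableSpace S] (μ : Measure S)
    [IsFiniteMeasure μ] (ν : Set S → ℝ) (C : ℝ)
    (hadd : ∀ A B, MeasurableSet A → MeasurableSet B → Disjoint A B → ν (A ∪ B) = ν A + ν B)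
    (hb : ∀ A, MeasurableSet A → |ν A| ≤ C * μ.real A) :
    ∃ d : S → ℝ, Measurable d ∧ Integrable d μ ∧ ∀ A, MeasurableSet A → ∫ v in A, d v ∂μ = ν A := by
  classical
  have h0 : ν ∅ = 0 := by simpa using hb ∅ .empty
  let σ : SignedMeasure S :=
    { measureOf' := fun A => if MeasurableSet A then ν A else 0
      empty' := by simp [h0]
      not_measurable' := fun A hA => by simp [hA]
      m_iUnion' := by
        intro f hf hd
        have hU := MeasurableSet.iUnion hf
        simp only [hf, hU, if_true]
        have hfin : ∀ t : Finset ℕ, ∑ i ∈ t, ν (f i) = ν (⋃ i ∈ t, f i) := by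
          intro t
          induction t using Finset.induction_on with
          | empty => simp [h0]
          | insert a t ha ih =>
            rw [Finset.sum_insert ha, ih, Finset.set_biUnion_insert, hadd _ _ (hf a)
              (t.measurableSet_biUnion fun i _ => hf i)]
            refine Set.disjoint_iUnion₂_right.2 fun i hi => hd ?_
            rintro rfl
            exact ha hi
        have hμ : HasSum (fun i => μ.real (f i)) (μ.real (⋃ i, f i)) := by
          have := μ.toSignedMeasure.m_iUnion hf hd
          simpa [Measure.toSignedMeasure_apply_measurable, hf, hU] using this
        rw [HasSum, tendsto_iff_norm_sub_tendsto_zero]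
        -- Domination by `C μ` upgrades finite to countable additivity: the remainder is at most `C`
        -- times the `μ`-mass of the tail.
        have hlim : Tendsto (fun t : Finset ℕ => C * (μ.real (⋃ i, f i) - ∑ i ∈ t, μ.real (f i)))
            atTop (𝓝 0) := by
          have := (tendsto_const_nhds (x := μ.real (⋃ i, f i))).sub hμ
          simpa using this.const_mul C
        refine squeeze_zero (fun _ => norm_nonneg _) (fun t => ?_) hlim
        have hm : MeasurableSet (⋃ i ∈ t, f i) := t.measurableSet_biUnion fun i _ => hf i
        have hsub : (⋃ i ∈ t, f i) ⊆ ⋃ i, f i := Set.iUnion₂_subset_iUnion _ _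
        have h1 : ν (⋃ i, f i) = ν (⋃ i ∈ t, f i) + ν ((⋃ i, f i) \ ⋃ i ∈ t, f i) := by
          rw [← hadd _ _ hm (hU.diff hm) Set.disjoint_sdiff_right, Set.union_sdiff_cancel hsub]
        have h2 : μ.real ((⋃ i, f i) \ ⋃ i ∈ t, f i)
            = μ.real (⋃ i, f i) - ∑ i ∈ t, μ.real (f i) := by
          rw [measureReal_sdiff hsub hm, measureReal_biUnion_finset (fun i _ j _ hij => hd hij)
            (fun i _ => hf i)]
        rw [hfin, h1, sub_add_cancel_left, norm_neg, Real.norm_eq_abs, ← h2]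
        exact hb _ (hU.diff hm) }
  have hσ : ∀ A, MeasurableSet A → σ A = ν A := fun A hA => by
    change (if MeasurableSet A then ν A else 0) = ν A
    simp [hA]
  have hac : σ ≪ᵥ μ.toENNRealVectorMeasure := by
    refine VectorMeasure.AbsolutelyContinuous.mk fun A hA h => ?_
    rw [Measure.toENNRealVectorMeasure_apply_measurable hA] at h
    rw [hσ A hA]
    simpa [measureReal_def, h] using hb A hA
  refine ⟨σ.rnDeriv μ, SignedMeasure.measurable_rnDeriv σ μ,
    SignedMeasure.integrable_rnDeriv σ μ, fun A hA => ?_⟩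
  rw [← withDensityᵥ_apply (SignedMeasure.integrable_rnDeriv σ μ) hA,
    SignedMeasure.withDensityᵥ_rnDeriv_eq σ μ hac, hσ A hA]

/-! ### Sublinear functionals and Strassen's disintegration -/

section Sublinear

variable {X : Type*} [NormedAddCommGroup X] [NormedSpace ℝ X]

/-- A bounded sublinear function dominates some continuous linear functional. -/
theorem exists_strongDual_le_sublinear (N : X → ℝ) (K : NNReal)
    (hhom : ∀ c : ℝ, 0 < c → ∀ h, N (c • h) = c * N h)
    (hsub : ∀ h k, N (h + k) ≤ N h + N k) (hbd : ∀ h, |N h| ≤ K * ‖h‖) :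
    ∃ f : StrongDual ℝ X, ∀ h, f h ≤ N h := by
  have hN0 : N 0 = 0 := by simpa using hbd 0
  obtain ⟨f, -, hf⟩ := exists_extension_of_le_sublinear
    (LinearPMap.mk (⊥ : Submodule ℝ X) (0 : (⊥ : Submodule ℝ X) →ₗ[ℝ] ℝ)) N hhom hsub (by
      rintro ⟨x, hx⟩
      rw [Submodule.mem_bot] at hx
      subst hx
      exact hN0.ge)
  refine ⟨f.mkContinuous K fun h => abs_le.2 ⟨?_, ?_⟩, hf⟩
  · have h1 := hf (-h)
    rw [map_neg] at h1
    have h2 := le_of_abs_le (hbd (-h))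
    rw [norm_neg] at h2
    linarith
  · exact (hf h).trans (le_of_abs_le (hbd h))

variable {S : Type*} [MeasurableSpace S]

/-- Hahn-Banach on simple functions: a functional dominated by an integral of sublinear functions
on constants extends to a dominated functional on all simple functions. -/
theorem exists_linearMap_simpleFunc_le_integral (μ : Measure S) [IsProbabilityMeasure μ]
    (N : S → X → ℝ) (K : NNReal)
    (hhom : ∀ v, ∀ c : ℝ, 0 < c → ∀ h, N v (c • h) = c * N v h)
    (hsub : ∀ v h k, N v (h + k) ≤ N v h + N v k) (hbd : ∀ v h, |N v h| ≤ K * ‖h‖)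
    (hmeas : ∀ h, Measurable fun v => N v h)
    (l : StrongDual ℝ X) (hl : ∀ h, l h ≤ ∫ v, N v h ∂μ) :
    ∃ F : SimpleFunc S X →ₗ[ℝ] ℝ, (∀ h, F (SimpleFunc.const S h) = l h) ∧
      ∀ f, F f ≤ ∫ v, N v (f v) ∂μ := by
  have hint : ∀ f : SimpleFunc S X, Integrable (fun v => N v (f v)) μ := by
    intro f
    obtain ⟨C, hC⟩ := (f.map fun x => K * ‖x‖).exists_forall_norm_le
    refine Integrable.of_bound
      (f.measurable_bind (fun h v => N v h) hmeas).aestronglyMeasurable C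
      (ae_of_all _ fun v => ?_)
    exact (hbd v (f v)).trans ((le_abs_self _).trans (hC v))
  have hS : Nonempty S := nonempty_of_isProbabilityMeasure μ
  let v₀ : S := hS.some
  let cst : X →ₗ[ℝ] SimpleFunc S X :=
    { toFun := fun h => SimpleFunc.const S h
      map_add' := fun h k => rfl
      map_smul' := fun c h => rfl }
  -- Evaluation at one point `v₀` is linear on all simple functions and equals `l` on constants, so
  -- no inverse of `cst` is needed.
  let ev : SimpleFunc S X →ₗ[ℝ] ℝ :=
    { toFun := fun f => l (f v₀)
      map_add' := fun f g => by simp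
      map_smul' := fun c f => by simp }
  obtain ⟨F, hF1, hF2⟩ := exists_extension_of_le_sublinear
    (LinearPMap.mk (LinearMap.range cst) (ev.domRestrict (LinearMap.range cst)))
    (fun f => ∫ v, N v (f v) ∂μ)
    (fun c hc f => by
      simp only [SimpleFunc.coe_smul, Pi.smul_apply, hhom _ c hc, integral_const_mul])
    (fun f g => by
      rw [← integral_add (hint f) (hint g)]
      exact integral_mono (hint (f + g)) ((hint f).add (hint g)) fun v => hsub v _ _)
    (by
      rintro ⟨_, h, rfl⟩
      exact hl h)
  exact ⟨F, fun h => hF1 ⟨cst h, h, rfl⟩, hF2⟩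

end Sublinear

section Sublinear

theorem lipschitzWith_of_sublinear {X : Type*} [SeminormedAddCommGroup X] {N : X → ℝ} {K : NNReal}
    (hsub : ∀ h k, N (h + k) ≤ N h + N k) (hbd : ∀ h, |N h| ≤ K * ‖h‖) : LipschitzWith K N := by
  have key : ∀ h k, N h - N k ≤ K * ‖h - k‖ := fun h k => by
    have h1 := hsub (h - k) k
    rw [sub_add_cancel] at h1
    have h2 := le_of_abs_le (hbd (h - k))
    linarith
  refine LipschitzWith.of_dist_le_mul fun h k => ?_
  rw [Real.dist_eq, dist_eq_norm]
  refine abs_sub_le_iff.2 ⟨key h k, ?_⟩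
  rw [norm_sub_rev]
  exact key k h

variable {X : Type*} [NormedAddCommGroup X] [NormedSpace ℝ X]

/-- An additive function on a dense additive subgroup that is dominated by a bounded sublinear
function extends to a dominated continuous linear functional. -/
theorem exists_strongDual_extend {J : Type*} [AddCommGroup J] (u : J →+ X) (hu : DenseRange u)
    (δ : J →+ ℝ) {N : X → ℝ} {K : NNReal}
    (hsub : ∀ h k, N (h + k) ≤ N h + N k) (hbd : ∀ h, |N h| ≤ K * ‖h‖)
    (hδ : ∀ j, δ j ≤ N (u j)) :
    ∃ f : StrongDual ℝ X, (∀ h, f h ≤ N h) ∧ ∀ j, f (u j) = δ j := by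
  have hle : ∀ j, |δ j| ≤ K * ‖u j‖ := fun j => abs_le.2 ⟨by
    have h1 := hδ (-j)
    have h2 := le_of_abs_le (hbd (u (-j)))
    rw [map_neg] at h1 h2
    rw [map_neg] at h1
    rw [norm_neg] at h2
    linarith, (hδ j).trans (le_of_abs_le (hbd _))⟩
  have hdiff : ∀ j k, |δ j - δ k| ≤ K * ‖u j - u k‖ := fun j k => by
    simpa using hle (j - k)
  -- The values of `w` off the range of `u` are irrelevant. On the range, the bound `hdiff` makes
  -- the choice of preimage immaterial.
  let w : X → ℝ := fun x => δ (Function.invFun u x)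
  have hw : ∀ j, w (u j) = δ j := fun j => by
    have h1 : u (Function.invFun u (u j)) = u j := Function.invFun_eq ⟨j, rfl⟩
    have h2 := hdiff (Function.invFun u (u j)) j
    rw [h1, sub_self, norm_zero, mul_zero] at h2
    exact sub_eq_zero.1 (abs_nonpos_iff.1 h2)
  have hLip : LipschitzOnWith K w (Set.range u) := by
    refine LipschitzOnWith.of_dist_le_mul ?_
    rintro _ ⟨j, rfl⟩ _ ⟨k, rfl⟩
    rw [hw, hw, Real.dist_eq, dist_eq_norm]
    exact hdiff j k
  obtain ⟨g, hg, hgw⟩ := hLip.extend_real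
  have hgu : ∀ j, g (u j) = δ j := fun j => by rw [← hgw ⟨j, rfl⟩, hw]
  have hadd : ∀ x y, g (x + y) = g x + g y := fun x y => by
    refine hu.induction_on₂ (p := fun x y => g (x + y) = g x + g y) ?_ (fun j k => ?_) x y
    · exact isClosed_eq (hg.continuous.comp (by fun_prop))
        ((hg.continuous.comp continuous_fst).add (hg.continuous.comp continuous_snd))
    · rw [← map_add, hgu, hgu, hgu, map_add]
  -- A continuous additive map is real-linear, so additivity on a dense subgroup suffices.
  refine ⟨(AddMonoidHom.mk' g hadd).toRealLinearMap hg.continuous, fun h => ?_, hgu⟩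
  refine hu.induction_on (p := fun h => g h ≤ N h) h ?_ (fun j => (hgu j).trans_le (hδ j))
  exact isClosed_le hg.continuous (lipschitzWith_of_sublinear hsub hbd).continuous

variable {S : Type*} [MeasurableSpace S]

/-- **Strassen's disintegration theorem**: a functional dominated by the integral of a measurable
family of bounded sublinear functions is the Bochner integral of dominated functionals. -/
theorem exists_integral_eq_of_le_integral_sublinear [TopologicalSpace.SeparableSpace X]
    [TopologicalSpace.SeparableSpace (StrongDual ℝ X)]
    (μ : Measure S) [IsProbabilityMeasure μ] (N : S → X → ℝ) (K : NNReal)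
    (hhom : ∀ v, ∀ c : ℝ, 0 < c → ∀ h, N v (c • h) = c * N v h)
    (hsub : ∀ v h k, N v (h + k) ≤ N v h + N v k) (hbd : ∀ v h, |N v h| ≤ K * ‖h‖)
    (hmeas : ∀ h, Measurable fun v => N v h)
    (l : StrongDual ℝ X) (hl : ∀ h, l h ≤ ∫ v, N v h ∂μ) :
    ∃ s : S → StrongDual ℝ X, Integrable s μ ∧ (∀ v h, s v h ≤ N v h) ∧ l = ∫ v, s v ∂μ := by
  classical
  obtain ⟨F, hF1, hF2⟩ := exists_linearMap_simpleFunc_le_integral μ N K hhom hsub hbd hmeas l hl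
  have hN0 : ∀ v, N v 0 = 0 := fun v => by simpa using hbd v 0
  have hNint : ∀ h, Integrable (fun v => N v h) μ := fun h =>
    Integrable.of_bound (hmeas h).aestronglyMeasurable (K * ‖h‖) (ae_of_all _ fun v => hbd v h)
  -- `ν h A` is the value of `F` on `h · 1_A`; for fixed `h` it is dominated by a multiple of `μ`,
  -- hence has a density `D h`.
  let ν : X → Set S → ℝ := fun h A => F ((SimpleFunc.const S h).restrict A)
  have hνle : ∀ h A, MeasurableSet A → ν h A ≤ ∫ v in A, N v h ∂μ := fun h A hA => by
    refine (hF2 _).trans_eq ?_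
    rw [← integral_indicator hA]
    congr 1 with v
    by_cases hv : v ∈ A <;> simp [SimpleFunc.restrict_apply _ hA, hv, hN0]
  have hνadd : ∀ h k A, MeasurableSet A → ν (h + k) A = ν h A + ν k A := fun h k A hA => by
    refine Eq.trans (congrArg F ?_) (map_add F _ _)
    ext v
    by_cases hv : v ∈ A <;> simp [SimpleFunc.restrict_apply _ hA, hv]
  have hνle' : ∀ h A, MeasurableSet A → ν h A ≤ (K * ‖h‖) * μ.real A := fun h A hA => by
    refine (hνle h A hA).trans ?_
    have := integral_mono (μ := μ.restrict A) (hNint h).integrableOn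
      (integrable_const (K * ‖h‖)) (fun v => le_of_abs_le (hbd v h))
    simpa [mul_comm] using this
  have hνabs : ∀ h A, MeasurableSet A → |ν h A| ≤ (K * ‖h‖) * μ.real A := fun h A hA => by
    refine abs_le.2 ⟨?_, hνle' h A hA⟩
    have h1 := hνadd h (-h) A hA
    have h2 : ν (h + -h) A = 0 := by
      have : (SimpleFunc.const S (h + -h)).restrict A = 0 := by
        ext v
        by_cases hv : v ∈ A <;> simp [SimpleFunc.restrict_apply _ hA, hv]
      simp only [ν, this, map_zero]
    have h3 := hνle' (-h) A hA
    rw [norm_neg] at h3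
    linarith
  have hνU : ∀ h A B, MeasurableSet A → MeasurableSet B → Disjoint A B →
      ν h (A ∪ B) = ν h A + ν h B := fun h A B hA hB hd => by
    refine Eq.trans (congrArg F ?_) (map_add F _ _)
    ext v
    by_cases hv : v ∈ A
    · have : v ∉ B := Set.disjoint_left.1 hd hv
      simp [SimpleFunc.restrict_apply, hA, hB, hA.union hB, hv, this]
    · by_cases hv' : v ∈ B <;> simp [SimpleFunc.restrict_apply, hA, hB, hA.union hB, hv, hv']
  choose D hDm hDi hD using fun h => exists_density_of_abs_le μ (ν h) _ (hνU h) (hνabs h)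
  -- Integer combinations of a dense sequence form a countable dense subgroup, so additivity and
  -- domination of the densities hold on it outside a single null set.
  let u : (ℕ →₀ ℤ) →+ X :=
    (Finsupp.linearCombination ℤ (TopologicalSpace.denseSeq X)).toAddMonoidHom
  have hu : DenseRange u := by
    refine (TopologicalSpace.denseRange_denseSeq X).mono ?_
    rintro _ ⟨n, rfl⟩
    exact ⟨Finsupp.single n 1, by simp [u]⟩
  let G : Set S := {v | (∀ j k, D (u (j + k)) v = D (u j) v + D (u k) v) ∧
    ∀ j, D (u j) v ≤ N v (u j)}
  have hGm : MeasurableSet G := by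
    have : G = (⋂ j, ⋂ k, {v | D (u (j + k)) v = D (u j) v + D (u k) v}) ∩
        ⋂ j, {v | D (u j) v ≤ N v (u j)} := by
      ext v
      simp [G]
    rw [this]
    exact (MeasurableSet.iInter fun j => MeasurableSet.iInter fun k =>
      measurableSet_eq_fun (hDm _) ((hDm _).add (hDm _))).inter
      (MeasurableSet.iInter fun j => measurableSet_le (hDm _) (hmeas _))
  have hGae : ∀ᵐ v ∂μ, v ∈ G := by
    have h1 : ∀ᵐ v ∂μ, ∀ j k, D (u (j + k)) v = D (u j) v + D (u k) v := by
      refine ae_all_iff.2 fun j => ae_all_iff.2 fun k => ?_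
      refine ae_eq_of_forall_setIntegral_eq_of_sigmaFinite
        (fun _ _ _ => (hDi _).integrableOn)
        (fun _ _ _ => ((hDi _).add (hDi _)).integrableOn) fun A hA _ => ?_
      rw [hD _ A hA, integral_add (hDi _).integrableOn (hDi _).integrableOn, hD _ A hA, hD _ A hA,
        map_add, hνadd _ _ _ hA]
    have h2 : ∀ᵐ v ∂μ, ∀ j, D (u j) v ≤ N v (u j) := by
      refine ae_all_iff.2 fun j => ?_
      refine ae_le_of_forall_setIntegral_le (hDi _) (hNint _) fun A hA _ => ?_
      rw [hD _ A hA]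
      exact hνle _ A hA
    filter_upwards [h1, h2] with v hv1 hv2 using ⟨hv1, hv2⟩
  have hs : ∀ v, ∃ f : StrongDual ℝ X, (∀ h, f h ≤ N v h) ∧ (v ∈ G → ∀ j, f (u j) = D (u j) v) := by
    intro v
    by_cases hv : v ∈ G
    · obtain ⟨f, hf1, hf2⟩ := exists_strongDual_extend u hu
        (AddMonoidHom.mk' (fun j => D (u j) v) hv.1) (hsub v) (hbd v) hv.2
      exact ⟨f, hf1, fun _ => hf2⟩
    -- The selection must be dominated for every `v`, so any dominated functional is taken on the
    -- exceptional null set.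
    · obtain ⟨f, hf⟩ := exists_strongDual_le_sublinear (N v) K (hhom v) (hsub v) (hbd v)
      exact ⟨f, hf, fun h => absurd h hv⟩
  choose s hsN hsD using hs
  have hsm : StronglyMeasurable (G.indicator s) := by
    refine stronglyMeasurable_of_measurable_apply fun h => ?_
    obtain ⟨x, hx, hxl⟩ := mem_closure_iff_seq_limit.1 (hu h)
    choose j hj using hx
    refine measurable_of_tendsto_metrizable
      (f := fun n v => G.indicator (fun v => D (u (j n)) v) v)
      (fun n => (hDm _).indicator hGm) (tendsto_pi_nhds.2 fun v => ?_)
    by_cases hv : v ∈ G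
    · simp only [hv, Set.indicator_of_mem]
      simp_rw [← hsD v hv, hj]
      exact ((s v).continuous.tendsto h).comp hxl
    · simp [hv]
  have hsae : G.indicator s =ᵐ[μ] s := by
    filter_upwards [hGae] with v hv
    simp [hv]
  have hsi : Integrable s μ := by
    refine Integrable.of_bound (hsm.aestronglyMeasurable.congr hsae) K (ae_of_all _ fun v => ?_)
    refine ContinuousLinearMap.opNorm_le_bound _ K.2 fun h => abs_le.2 ⟨?_, ?_⟩
    · have h1 := (hsN v (-h)).trans (le_of_abs_le (hbd v (-h)))
      rw [map_neg, norm_neg] at h1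
      exact neg_le.1 h1
    · exact (hsN v h).trans (le_of_abs_le (hbd v h))
  refine ⟨s, hsi, hsN, ContinuousLinearMap.coeFn_injective
    (hu.equalizer l.continuous (ContinuousLinearMap.continuous _) (funext fun j => ?_))⟩
  rw [Function.comp_apply, Function.comp_apply, ContinuousLinearMap.integral_apply hsi]
  have h1 : ∫ v, s v (u j) ∂μ = ∫ v, D (u j) v ∂μ := by
    refine integral_congr_ae ?_
    filter_upwards [hGae] with v hv using hsD v hv j
  rw [h1, ← setIntegral_univ, hD _ _ .univ, ← hF1]
  simp [ν]

end Sublinear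

/-! ### Clarke derivatives and integral functionals -/

section Clarke

theorem lipschitzOnWith_integral {S X : Type*} [MeasurableSpace S] [PseudoMetricSpace X]
    (μ : Measure S) [IsProbabilityMeasure μ] {e : S → X → ℝ}
    {φ : X → ℝ} {U : Set X} {K : NNReal} (hLip : ∀ v, LipschitzOnWith K (e v) U)
    (hi : ∀ y, Integrable (fun v => e v y) μ) (hφ : ∀ y, φ y = ∫ v, e v y ∂μ) :
    LipschitzOnWith K φ U := by
  refine LipschitzOnWith.of_dist_le_mul fun y hy z hz => ?_
  rw [hφ, hφ, dist_eq_norm, ← integral_sub (hi y) (hi z)]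
  simpa using norm_integral_le_of_norm_le_const (μ := μ) (f := fun v => e v y - e v z)
    (ae_of_all _ fun v => by
      rw [← dist_eq_norm]
      exact (hLip v).dist_le_mul y hy z hz)

theorem eventually_pos_snd {X : Type*} [TopologicalSpace X] (x : X) :
    ∀ᶠ p : X × ℝ in 𝓝 x ×ˢ 𝓝[>] (0 : ℝ), 0 < p.2 :=
  (tendsto_snd (f := 𝓝 x) (g := 𝓝[>] (0 : ℝ))).eventually self_mem_nhdsWithin

variable {X : Type*} [NormedAddCommGroup X] [NormedSpace ℝ X]

theorem tendsto_add_smul_nhds (x h : X) :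
    Tendsto (fun p : X × ℝ => p.1 + p.2 • h) (𝓝 x ×ˢ 𝓝[>] (0 : ℝ)) (𝓝 x) := by
  have h1 : Tendsto (fun p : X × ℝ => p.1 + p.2 • h) (𝓝 (x, (0 : ℝ))) (𝓝 (x + (0 : ℝ) • h)) :=
    Continuous.tendsto (by fun_prop) _
  rw [zero_smul, add_zero, nhds_prod_eq] at h1
  exact h1.mono_left (Filter.prod_mono le_rfl nhdsWithin_le_nhds)

theorem eventually_segment_mem {x : X} {U : Set X} (hU : U ∈ 𝓝 x) (h : X) :
    ∀ᶠ p : X × ℝ in 𝓝 x ×ˢ 𝓝[>] (0 : ℝ), p.1 ∈ U ∧ p.1 + p.2 • h ∈ U ∧ 0 < p.2 :=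
  (tendsto_fst.eventually hU).and
    (((tendsto_add_smul_nhds x h).eventually hU).and (eventually_pos_snd x))

theorem abs_diffQuotient_le {f : X → ℝ} {U : Set X} {K : NNReal} (hf : LipschitzOnWith K f U)
    {h : X} {p : X × ℝ} (hp : p.1 ∈ U ∧ p.1 + p.2 • h ∈ U ∧ 0 < p.2) :
    |(f (p.1 + p.2 • h) - f p.1) / p.2| ≤ K * ‖h‖ := by
  obtain ⟨h1, h2, h3⟩ := hp
  have := hf.dist_le_mul _ h2 _ h1
  rw [Real.dist_eq, dist_eq_norm, add_sub_cancel_left, norm_smul, Real.norm_eq_abs,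
    abs_of_pos h3] at this
  rw [abs_div, abs_of_pos h3, div_le_iff₀ h3]
  linarith

theorem clarkeDeriv_le_of_eventually_le {f : X → ℝ} {x h : X} {a : ℝ}
    (ha : ∀ᶠ p : X × ℝ in 𝓝 x ×ˢ 𝓝[>] (0 : ℝ), (f (p.1 + p.2 • h) - f p.1) / p.2 ≤ a) :
    clarkeDeriv f x h ≤ a :=
  limsup_le_of_le (by isBoundedDefault) (ha.mono fun _ hp => EReal.coe_le_coe_iff.2 hp)

/-- The difference quotients are eventually bounded by `K ‖h‖` in absolute value, so the limsup is
finite and later arguments can use real numbers. -/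
theorem coe_toReal_clarkeDeriv {f : X → ℝ} {x : X} {U : Set X} (hU : U ∈ 𝓝 x) {K : NNReal}
    (hf : LipschitzOnWith K f U) (h : X) :
    ((clarkeDeriv f x h).toReal : EReal) = clarkeDeriv f x h ∧
      |(clarkeDeriv f x h).toReal| ≤ K * ‖h‖ := by
  have hev := (eventually_segment_mem hU h).mono fun p hp => abs_diffQuotient_le hf hp
  have h1 : clarkeDeriv f x h ≤ ((K * ‖h‖ : ℝ) : EReal) :=
    clarkeDeriv_le_of_eventually_le (hev.mono fun p hp => le_of_abs_le hp)
  have h2 : ((-(K * ‖h‖) : ℝ) : EReal) ≤ clarkeDeriv f x h :=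
    le_limsup_of_frequently_le
      (hev.mono fun p hp => EReal.coe_le_coe_iff.2 (neg_le_of_abs_le hp)).frequently
      (by isBoundedDefault)
  have h3 : ((clarkeDeriv f x h).toReal : EReal) = clarkeDeriv f x h :=
    EReal.coe_toReal (ne_top_of_le_ne_top (EReal.coe_ne_top _) h1)
      (ne_bot_of_le_ne_bot (EReal.coe_ne_bot _) h2)
  refine ⟨h3, abs_le.2 ⟨?_, ?_⟩⟩
  · rwa [← h3, EReal.coe_le_coe_iff] at h2
  · rwa [← h3, EReal.coe_le_coe_iff] at h1

theorem eventually_lt_of_clarkeDeriv_lt {f : X → ℝ} {x h : X} {a : ℝ}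
    (ha : clarkeDeriv f x h < a) :
    ∀ᶠ p : X × ℝ in 𝓝 x ×ˢ 𝓝[>] (0 : ℝ), (f (p.1 + p.2 • h) - f p.1) / p.2 < a :=
  (eventually_lt_of_limsup_lt ha (by isBoundedDefault)).mono
    fun _ hp => EReal.coe_lt_coe_iff.1 hp

section Lipschitz

variable {f : X → ℝ} {x : X} {U : Set X} {K : NNReal}

theorem eventually_lt_of_toReal_clarkeDeriv_lt (hU : U ∈ 𝓝 x) (hf : LipschitzOnWith K f U)
    {h : X} {a : ℝ} (ha : (clarkeDeriv f x h).toReal < a) :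
    ∀ᶠ p : X × ℝ in 𝓝 x ×ˢ 𝓝[>] (0 : ℝ), (f (p.1 + p.2 • h) - f p.1) / p.2 < a :=
  eventually_lt_of_clarkeDeriv_lt (by
    rw [← (coe_toReal_clarkeDeriv hU hf h).1]
    exact EReal.coe_lt_coe_iff.2 ha)

theorem toReal_clarkeDeriv_le_of_eventually_le (hU : U ∈ 𝓝 x) (hf : LipschitzOnWith K f U)
    {h : X} {a : ℝ}
    (ha : ∀ᶠ p : X × ℝ in 𝓝 x ×ˢ 𝓝[>] (0 : ℝ), (f (p.1 + p.2 • h) - f p.1) / p.2 ≤ a) :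
    (clarkeDeriv f x h).toReal ≤ a := by
  rw [← EReal.coe_le_coe_iff, (coe_toReal_clarkeDeriv hU hf h).1]
  exact clarkeDeriv_le_of_eventually_le ha

/-- The base point in the limsup is free to move: the quotient along `h + k` splits into one along
`k` at `y` and one along `h` at `y + t k`, which still tends to `x`. -/
theorem toReal_clarkeDeriv_add_le (hU : U ∈ 𝓝 x) (hf : LipschitzOnWith K f U) (h k : X) :
    (clarkeDeriv f x (h + k)).toReal ≤
      (clarkeDeriv f x h).toReal + (clarkeDeriv f x k).toReal := by
  refine le_of_forall_pos_le_add fun ε hε => ?_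
  refine toReal_clarkeDeriv_le_of_eventually_le hU hf ?_
  have h1 := eventually_lt_of_toReal_clarkeDeriv_lt hU hf
    (lt_add_of_pos_right (clarkeDeriv f x h).toReal (half_pos hε))
  have h2 := eventually_lt_of_toReal_clarkeDeriv_lt hU hf
    (lt_add_of_pos_right (clarkeDeriv f x k).toReal (half_pos hε))
  have h3 : Tendsto (fun p : X × ℝ => (p.1 + p.2 • k, p.2)) (𝓝 x ×ˢ 𝓝[>] (0 : ℝ))
      (𝓝 x ×ˢ 𝓝[>] (0 : ℝ)) := (tendsto_add_smul_nhds x k).prodMk tendsto_snd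
  filter_upwards [h3.eventually h1, h2] with p hp1 hp2
  have : (f (p.1 + p.2 • (h + k)) - f p.1) / p.2 =
      (f (p.1 + p.2 • k + p.2 • h) - f (p.1 + p.2 • k)) / p.2 +
        (f (p.1 + p.2 • k) - f p.1) / p.2 := by
    rw [← add_div, smul_add, add_comm (p.2 • h), ← add_assoc]
    ring
  rw [this]
  linarith

theorem toReal_clarkeDeriv_smul_le (hU : U ∈ 𝓝 x) (hf : LipschitzOnWith K f U) {c : ℝ}
    (hc : 0 < c) (h : X) :
    (clarkeDeriv f x (c • h)).toReal ≤ c * (clarkeDeriv f x h).toReal := by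
  refine le_of_forall_pos_le_add fun ε hε => ?_
  refine toReal_clarkeDeriv_le_of_eventually_le hU hf ?_
  have h1 := eventually_lt_of_toReal_clarkeDeriv_lt hU hf
    (lt_add_of_pos_right (clarkeDeriv f x h).toReal (div_pos hε hc))
  have h2 : Tendsto (fun t : ℝ => t * c) (𝓝[>] (0 : ℝ)) (𝓝[>] (0 : ℝ)) := by
    refine tendsto_nhdsWithin_iff.2 ⟨?_, ?_⟩
    · have : Tendsto (fun t : ℝ => t * c) (𝓝 0) (𝓝 (0 * c)) := Continuous.tendsto (by fun_prop) _
      rw [zero_mul] at this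
      exact this.mono_left nhdsWithin_le_nhds
    · filter_upwards [self_mem_nhdsWithin] with t ht using mul_pos ht hc
  have h3 : Tendsto (fun p : X × ℝ => (p.1, p.2 * c)) (𝓝 x ×ˢ 𝓝[>] (0 : ℝ))
      (𝓝 x ×ˢ 𝓝[>] (0 : ℝ)) := tendsto_fst.prodMk (h2.comp tendsto_snd)
  filter_upwards [h3.eventually h1, eventually_pos_snd x] with p hp1 hp2
  have : (f (p.1 + p.2 • (c • h)) - f p.1) / p.2 =
      c * ((f (p.1 + (p.2 * c) • h) - f p.1) / (p.2 * c)) := by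
    rw [smul_smul]
    field_simp
  rw [this]
  calc c * ((f (p.1 + (p.2 * c) • h) - f p.1) / (p.2 * c))
      ≤ c * ((clarkeDeriv f x h).toReal + ε / c) := by gcongr
    _ = _ := by field_simp

theorem toReal_clarkeDeriv_smul (hU : U ∈ 𝓝 x) (hf : LipschitzOnWith K f U) {c : ℝ}
    (hc : 0 < c) (h : X) :
    (clarkeDeriv f x (c • h)).toReal = c * (clarkeDeriv f x h).toReal := by
  refine le_antisymm (toReal_clarkeDeriv_smul_le hU hf hc h) ?_
  have := toReal_clarkeDeriv_smul_le hU hf (inv_pos.2 hc) (c • h)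
  rw [inv_smul_smul₀ hc.ne'] at this
  rwa [← div_eq_inv_mul, le_div_iff₀' hc] at this

end Lipschitz

/-- A continuous function on a convex set whose Clarke derivatives are bounded by `M ‖h‖` is
`M`-Lipschitz there. -/
theorem lipschitzOnWith_of_clarkeDeriv_le {f : X → ℝ} (hf : Continuous f) {B : Set X}
    (hB : Convex ℝ B) {M : NNReal}
    (hM : ∀ y ∈ B, ∀ h, clarkeDeriv f y h ≤ ((M * ‖h‖ : ℝ) : EReal)) : LipschitzOnWith M f B := by
  have key : ∀ y ∈ B, ∀ z ∈ B, f z - f y ≤ M * ‖z - y‖ := by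
    intro y hy z hz
    refine le_of_forall_pos_le_add fun ε hε => ?_
    have hcont : Continuous fun t : ℝ => f (y + t • (z - y)) := hf.comp (by fun_prop)
    -- Mean value inequality along the segment; the slack `ε` supplies the strict inequality of
    -- slopes.
    have := image_le_of_liminf_slope_right_lt_deriv_boundary
      (f := fun t : ℝ => f (y + t • (z - y))) (f' := fun _ => M * ‖z - y‖) (a := 0) (b := 1)
      hcont.continuousOn (fun t ht r hr => ?_)
      (B := fun t => f y + (M * ‖z - y‖ + ε) * t) (B' := fun _ => M * ‖z - y‖ + ε) (by simp)
      (fun t => by simpa using ((hasDerivAt_id t).const_mul (M * ‖z - y‖ + ε)).const_add (f y))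
      (fun t _ _ => by linarith) (Set.right_mem_Icc.2 zero_le_one)
    · simp only [one_smul, add_sub_cancel, mul_one] at this
      linarith
    · have hmem : y + t • (z - y) ∈ B := hB.add_smul_sub_mem hy hz ⟨ht.1, ht.2.le⟩
      have h1 := eventually_lt_of_clarkeDeriv_lt
        ((hM _ hmem (z - y)).trans_lt (EReal.coe_lt_coe_iff.2 hr))
      have h2 : Tendsto (fun s : ℝ => (y + t • (z - y), s - t)) (𝓝[>] t)
          (𝓝 (y + t • (z - y)) ×ˢ 𝓝[>] (0 : ℝ)) := by
        refine tendsto_const_nhds.prodMk (tendsto_nhdsWithin_iff.2 ⟨?_, ?_⟩)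
        · have : Tendsto (fun s : ℝ => s - t) (𝓝 t) (𝓝 (t - t)) :=
            Continuous.tendsto (by fun_prop) _
          rw [sub_self] at this
          exact this.mono_left nhdsWithin_le_nhds
        · filter_upwards [self_mem_nhdsWithin] with s hs using sub_pos.2 (Set.mem_Ioi.1 hs)
      refine ((h2.eventually h1).mono fun s hs => ?_).frequently
      rw [slope_def_field]
      simpa [add_assoc, ← add_smul] using hs
  refine LipschitzOnWith.of_dist_le_mul fun y hy z hz => ?_
  rw [Real.dist_eq, dist_eq_norm]
  refine abs_sub_le_iff.2 ⟨key z hz y hy, ?_⟩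
  rw [norm_sub_rev]
  exact key y hy z hz

variable {S : Type*} [MeasurableSpace S]

/-- Clarke derivatives of a uniformly Lipschitz measurable family are measurable in the parameter,
and the Clarke derivative of the integral is dominated by their integral. -/
theorem measurable_clarkeDeriv_and_le_integral [TopologicalSpace.SeparableSpace X]
    (μ : Measure S) [IsProbabilityMeasure μ] {e : S → X → ℝ} {φ : X → ℝ} {x : X} {U : Set X}
    (hU : U ∈ 𝓝 x) {K : NNReal} (hLip : ∀ v, LipschitzOnWith K (e v) U)
    (hm : ∀ y, Measurable fun v => e v y) (hi : ∀ y, Integrable (fun v => e v y) μ)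
    (hφ : ∀ y, φ y = ∫ v, e v y ∂μ) (h : X) :
    (Measurable fun v => (clarkeDeriv (e v) x h).toReal) ∧
      ∀ a : ℝ, (a : EReal) ≤ clarkeDeriv φ x h → a ≤ ∫ v, (clarkeDeriv (e v) x h).toReal ∂μ := by
  set 𝓕 : Filter (X × ℝ) := 𝓝 x ×ˢ 𝓝[>] (0 : ℝ) with h𝓕
  set W : Set (X × ℝ) := {p | p.1 ∈ U ∧ p.1 + p.2 • h ∈ U ∧ 0 < p.2} with hWdef
  have hW : W ∈ 𝓕 := eventually_segment_mem hU h
  obtain ⟨B, hB⟩ := 𝓕.exists_antitone_basis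
  have hBW : ∀ n, B n ∩ W ∈ 𝓕 := fun n => inter_mem (hB.mem n) hW
  have hne : ∀ n, Nonempty ↥(B n ∩ W) := fun n => (nonempty_of_mem (hBW n)).to_subtype
  have hsc : SecondCountableTopology X := UniformSpace.secondCountable_of_separable X
  let q : S → X × ℝ → ℝ := fun v p => (e v (p.1 + p.2 • h) - e v p.1) / p.2
  let w : ∀ n, ℕ → ↥(B n ∩ W) := fun n => TopologicalSpace.denseSeq ↥(B n ∩ W)
  -- By continuity of the quotient on `W`, the supremum over a dense sequence bounds it on all of `B
  -- n ∩ W`. It is measurable in `v` as a countable supremum, and tends to the Clarke derivative as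
  -- `n` grows.
  let M : ℕ → S → ℝ := fun n v => ⨆ k, q v (w n k)
  have hqb : ∀ v, ∀ p ∈ W, |q v p| ≤ K * ‖h‖ := fun v p hp => abs_diffQuotient_le (hLip v) hp
  have hbdd : ∀ n v, BddAbove (Set.range fun k => q v (w n k)) := fun n v =>
    ⟨K * ‖h‖, by rintro _ ⟨k, rfl⟩; exact le_of_abs_le (hqb v _ (w n k).2.2)⟩
  have hqm : ∀ p, Measurable fun v => q v p := fun p => ((hm _).sub (hm _)).div_const _
  have hMm : ∀ n, Measurable (M n) := fun n => Measurable.iSup fun k => hqm _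
  have hqc : ∀ v, ContinuousOn (q v) W := fun v => by
    refine ContinuousOn.div (ContinuousOn.sub ?_ ?_) continuousOn_snd fun p hp => hp.2.2.ne'
    · exact (hLip v).continuousOn.comp (by fun_prop) fun p hp => hp.2.1
    · exact (hLip v).continuousOn.comp (by fun_prop) fun p hp => hp.1
  have hqM : ∀ n v, ∀ p ∈ B n ∩ W, q v p ≤ M n v := fun n v p hp => by
    have hc : Continuous fun p : ↥(B n ∩ W) => q v p :=
      continuousOn_iff_continuous_domRestrict.1 ((hqc v).mono Set.inter_subset_right)
    exact (TopologicalSpace.denseRange_denseSeq ↥(B n ∩ W)).induction_on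
      (p := fun p => q v p ≤ M n v) ⟨p, hp⟩ (isClosed_le hc continuous_const)
      (fun k => le_ciSup (hbdd n v) k)
  have hMabs : ∀ n v, |M n v| ≤ K * ‖h‖ := fun n v => abs_le.2
    ⟨(neg_le_of_abs_le (hqb v _ (w n 0).2.2)).trans (le_ciSup (hbdd n v) 0),
      ciSup_le fun k => le_of_abs_le (hqb v _ (w n k).2.2)⟩
  have hlim : ∀ v, Tendsto (fun n => M n v) atTop (𝓝 (clarkeDeriv (e v) x h).toReal) := by
    intro v
    refine tendsto_order.2 ⟨fun a ha => ?_, fun a ha => ?_⟩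
    · refine Eventually.of_forall fun n => ha.trans_le ?_
      exact toReal_clarkeDeriv_le_of_eventually_le hU (hLip v)
        (Filter.mem_of_superset (hBW n) fun p hp => hqM n v p hp)
    · obtain ⟨b, hb1, hb2⟩ := exists_between ha
      obtain ⟨n, hn⟩ := hB.mem_iff.1 (eventually_lt_of_toReal_clarkeDeriv_lt hU (hLip v) hb1)
      filter_upwards [eventually_ge_atTop n] with k hk
      refine (ciSup_le fun j => ?_).trans_lt hb2
      exact (hn (hB.antitone hk (w k j).2.1)).le
  have hmeas : Measurable fun v => (clarkeDeriv (e v) x h).toReal :=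
    measurable_of_tendsto_metrizable hMm (tendsto_pi_nhds.2 hlim)
  refine ⟨hmeas, fun a ha => ?_⟩
  have hMi : ∀ n, Integrable (M n) μ := fun n =>
    Integrable.of_bound (hMm n).aestronglyMeasurable _ (ae_of_all _ fun v => hMabs n v)
  have hlimI : Tendsto (fun n => ∫ v, M n v ∂μ) atTop
      (𝓝 (∫ v, (clarkeDeriv (e v) x h).toReal ∂μ)) :=
    tendsto_integral_of_dominated_convergence (fun _ => K * ‖h‖)
      (fun n => (hMm n).aestronglyMeasurable) (integrable_const _)
      (fun n => ae_of_all _ fun v => hMabs n v) (ae_of_all _ hlim)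
  -- For each `n`, quotients of `φ` on `B n ∩ W` are integrals of quotients of `e v`, hence at most
  -- the integral of `M n`; dominated convergence then passes to the limit.
  refine ge_of_tendsto' hlimI fun n => EReal.coe_le_coe_iff.1 (ha.trans ?_)
  refine clarkeDeriv_le_of_eventually_le (Filter.mem_of_superset (hBW n) fun p hp => ?_)
  change (φ (p.1 + p.2 • h) - φ p.1) / p.2 ≤ _
  rw [hφ, hφ, ← integral_sub (hi _) (hi _), ← integral_div]
  exact integral_mono (((hi _).sub (hi _)).div_const _) (hMi n) fun v => hqM n v p hp

/-- **Clarke's theorem on integral functionals**: the Clarke subdifferential of the integral of a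
uniformly Lipschitz family is contained in the Aumann integral of the subdifferentials. -/
theorem clarkeSubdiff_integral_subset [TopologicalSpace.SeparableSpace X]
    [TopologicalSpace.SeparableSpace (StrongDual ℝ X)]
    (μ : Measure S) [IsProbabilityMeasure μ] {e : S → X → ℝ} {φ : X → ℝ} {x : X} {U : Set X}
    (hU : U ∈ 𝓝 x) {K : NNReal} (hLip : ∀ v, LipschitzOnWith K (e v) U)
    (hm : ∀ y, Measurable fun v => e v y) (hi : ∀ y, Integrable (fun v => e v y) μ)
    (hφ : ∀ y, φ y = ∫ v, e v y ∂μ) :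
    clarkeSubdiff φ x ⊆ aumannIntegral μ fun v => clarkeSubdiff (e v) x := by
  intro l hl
  have H := measurable_clarkeDeriv_and_le_integral μ hU hLip hm hi hφ
  obtain ⟨s, hs1, hs2, hs3⟩ := exists_integral_eq_of_le_integral_sublinear μ
    (fun v h => (clarkeDeriv (e v) x h).toReal) K
    (fun v c hc h => toReal_clarkeDeriv_smul hU (hLip v) hc h)
    (fun v h k => toReal_clarkeDeriv_add_le hU (hLip v) h k)
    (fun v h => (coe_toReal_clarkeDeriv hU (hLip v) h).2)
    (fun h => (H h).1) l (fun h => (H h).2 _ (hl h))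
  refine ⟨s, hs1, fun v h => ?_, hs3⟩
  rw [← (coe_toReal_clarkeDeriv hU (hLip v) h).1]
  exact EReal.coe_le_coe_iff.2 (hs2 v h)

end Clarke

/-! ### Polar coordinates and the Gaussian law -/

section Polar

variable {E : Type*} [NormedAddCommGroup E] [NormedSpace ℝ E] [MeasurableSpace E] [BorelSpace E]
  [FiniteDimensional ℝ E] [Nontrivial E]

/-- Integration in polar coordinates. -/
theorem lintegral_eq_lintegral_toSphere (μ : Measure E) [μ.IsAddHaarMeasure] {F : E → ENNReal}
    (hF : Measurable F) :
    ∫⁻ x, F x ∂μ = ∫⁻ v : Metric.sphere (0 : E) 1, (∫⁻ r in Set.Ioi (0 : ℝ),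
      ENNReal.ofReal (r ^ (Module.finrank ℝ E - 1)) * F (r • (v : E))) ∂μ.toSphere := by
  have h1 : ∫⁻ x, F x ∂μ = ∫⁻ x in ({0}ᶜ : Set E), F x ∂μ := by
    rw [Measure.restrict_eq_self_of_ae_mem]
    exact compl_mem_ae_iff.2 (measure_singleton 0)
  rw [h1, ← lintegral_subtype_comap (measurableSet_singleton (0 : E)).compl]
  have h2 : ∀ x : ({0}ᶜ : Set E), F x =
      F ((homeomorphUnitSphereProd E x).2.1 • ((homeomorphUnitSphereProd E x).1 : E)) := by
    intro x
    have hx : ‖(x : E)‖ ≠ 0 := norm_ne_zero_iff.2 x.2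
    rw [homeomorphUnitSphereProd_apply_fst_coe, homeomorphUnitSphereProd_apply_snd_coe,
      smul_inv_smul₀ hx]
  simp_rw [h2]
  have hG : Measurable fun p : Metric.sphere (0 : E) 1 × Set.Ioi (0 : ℝ) =>
      F (p.2.1 • (p.1 : E)) := hF.comp (by fun_prop)
  rw [(Measure.measurePreserving_homeomorphUnitSphereProd μ).lintegral_comp_emb
    (Homeomorph.measurableEmbedding _) (fun p => F (p.2.1 • (p.1 : E))),
    lintegral_prod _ hG.aemeasurable]
  refine lintegral_congr fun v => ?_
  have hm : Measurable fun r : ℝ => F (r • (v : E)) := hF.comp (by fun_prop)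
  refine (lintegral_withDensity_eq_lintegral_mul _ (by fun_prop)
    (hm.comp measurable_subtype_coe)).trans ?_
  rw [← lintegral_subtype_comap measurableSet_Ioi]
  rfl

end Polar

section Gaussian

open ProbabilityTheory

variable {m : ℕ}

/-- The standard Gaussian distribution of Euclidean space has the usual density. -/
theorem stdGaussian_eq_withDensity :
    stdGaussian (EuclideanSpace ℝ (Fin m)) =
      (volume : Measure (EuclideanSpace ℝ (Fin m))).withDensity fun x =>
        ENNReal.ofReal (((2 * Real.pi) ^ ((m : ℝ) / 2))⁻¹ * Real.exp (-‖x‖ ^ 2 / 2)) := by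
  set E := EuclideanSpace ℝ (Fin m)
  set c : ℝ := ((2 * Real.pi) ^ ((m : ℝ) / 2))⁻¹ with hc
  have hc0 : 0 < c := by positivity
  have hint : Integrable (fun x : E => c * Real.exp (-‖x‖ ^ 2 / 2)) := by
    have h := (GaussianFourier.integrable_cexp_neg_mul_sq_norm_add (V := E) (b := 1 / 2)
      (by norm_num) 0 0).re
    refine (h.const_mul c).congr (ae_of_all _ fun x => ?_)
    simp only [zero_mul, add_zero]
    rw [show -(1 / 2 : ℂ) * (‖x‖ : ℂ) ^ 2 = ((-‖x‖ ^ 2 / 2 : ℝ) : ℂ) by push_cast; ring,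
      ← Complex.ofReal_exp]
    rfl
  have hfin : IsFiniteMeasure ((volume : Measure E).withDensity fun x =>
      ENNReal.ofReal (c * Real.exp (-‖x‖ ^ 2 / 2))) :=
    isFiniteMeasure_withDensity_ofReal hint.2
  refine Measure.ext_of_charFun ?_
  ext t
  rw [charFun_stdGaussian, charFun_apply, integral_withDensity_eq_integral_toReal_smul
    (by fun_prop) (ae_of_all _ fun _ => ENNReal.ofReal_lt_top)]
  have h1 : ∀ x : E, (ENNReal.ofReal (c * Real.exp (-‖x‖ ^ 2 / 2))).toReal •
      Complex.exp (↑(inner ℝ x t) * Complex.I) =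
      (c : ℂ) * Complex.exp (-(1 / 2 : ℂ) * ↑‖x‖ ^ 2 + Complex.I * ↑(inner ℝ t x)) := by
    intro x
    rw [ENNReal.toReal_ofReal (by positivity), Complex.real_smul, Complex.ofReal_mul, mul_assoc,
      Complex.ofReal_exp, ← Complex.exp_add, real_inner_comm]
    congr 2
    push_cast
    ring
  simp_rw [h1]
  rw [integral_const_mul, GaussianFourier.integral_cexp_neg_mul_sq_norm_add (by norm_num)]
  -- The Gaussian integral at zero frequency equals `1 / c`, so only the exponential factor of the
  -- characteristic function remains.
  have h2 : (c : ℂ) * ((Real.pi : ℂ) / (1 / 2 : ℂ)) ^ ((Module.finrank ℝ E : ℂ) / 2) = 1 := by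
    have : ((Real.pi : ℂ) / (1 / 2 : ℂ)) ^ ((Module.finrank ℝ E : ℂ) / 2) =
        (((2 * Real.pi) ^ ((m : ℝ) / 2) : ℝ) : ℂ) := by
      rw [Complex.ofReal_cpow (by positivity)]
      simp only [E, finrank_euclideanSpace_fin]
      push_cast
      congr 1
      ring
    rw [this, ← Complex.ofReal_mul, hc, inv_mul_cancel₀ (by positivity), Complex.ofReal_one]
  rw [← mul_assoc, h2, one_mul, Complex.I_sq]
  congr 1
  ring

/-- `𝒩(0, L Lᵀ)` is the image of the standard Gaussian distribution under `L`. -/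
theorem multivariateGaussian_eq_map (L : Matrix (Fin m) (Fin m) ℝ)
    (hR : (L * L.transpose).PosSemidef) :
    multivariateGaussian 0 (L * L.transpose) =
      (stdGaussian (EuclideanSpace ℝ (Fin m))).map (euclOp L) := by
  have : IsProbabilityMeasure ((stdGaussian (EuclideanSpace ℝ (Fin m))).map (euclOp L)) :=
    Measure.isProbabilityMeasure_map (by fun_prop)
  refine Measure.ext_of_charFun ?_
  ext t
  have h1 : charFun ((stdGaussian (EuclideanSpace ℝ (Fin m))).map (euclOp L)) t =
      charFun (stdGaussian (EuclideanSpace ℝ (Fin m)))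
        (ContinuousLinearMap.adjoint (euclOp L) t) := by
    rw [charFun_apply, charFun_apply, integral_map (by fun_prop) (by fun_prop)]
    simp_rw [ContinuousLinearMap.adjoint_inner_right]
  rw [h1, charFun_stdGaussian, charFun_multivariateGaussian hR, inner_zero_right]
  have h2 : ‖ContinuousLinearMap.adjoint (euclOp L) t‖ ^ 2 =
      t.ofLp ⬝ᵥ (L * L.transpose).mulVec t.ofLp := by
    rw [← real_inner_self_eq_norm_sq, ContinuousLinearMap.adjoint_inner_left,
      ← ContinuousLinearMap.star_eq_adjoint, ← map_star, ← mul_apply_eq_comp,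
      ← map_mul, Matrix.inner_toEuclideanCLM, Matrix.star_eq_conjTranspose,
      Matrix.conjTranspose_eq_transpose_of_trivial]
  rw [← Complex.ofReal_pow, h2]
  simp [neg_div]

/-- The total mass of the sphere matches the Gaussian and the Chi-density constants. -/
theorem toSphere_univ_mul_gaussianConst (hm : 1 ≤ m) :
    (volume : Measure (EuclideanSpace ℝ (Fin m))).toSphere Set.univ *
      ENNReal.ofReal (((2 * Real.pi) ^ ((m : ℝ) / 2))⁻¹) =
    ENNReal.ofReal ((2 : ℝ) ^ (1 - (m : ℝ) / 2) / Real.Gamma ((m : ℝ) / 2)) := by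
  have : Nonempty (Fin m) := ⟨⟨0, hm⟩⟩
  have hm0 : (0 : ℝ) < m := by exact_mod_cast hm
  have hG : 0 < Real.Gamma ((m : ℝ) / 2) := Real.Gamma_pos_of_pos (by positivity)
  rw [Measure.toSphere_apply_univ, EuclideanSpace.volume_ball, finrank_euclideanSpace_fin,
    Fintype.card_fin, ENNReal.ofReal_one, one_pow, one_mul, ← ENNReal.ofReal_natCast,
    ← ENNReal.ofReal_mul (by positivity), ← ENNReal.ofReal_mul (by positivity),
    Real.Gamma_add_one (by positivity)]
  congr 1
  have h1 : √Real.pi ^ m = Real.pi ^ ((m : ℝ) / 2) := by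
    rw [Real.sqrt_eq_rpow, ← Real.rpow_natCast, ← Real.rpow_mul Real.pi_pos.le]
    congr 1
    ring
  rw [h1, Real.mul_rpow (by norm_num) Real.pi_pos.le, Real.rpow_sub (by norm_num), Real.rpow_one]
  have h2 : 0 < Real.pi ^ ((m : ℝ) / 2) := by positivity
  have h3 : 0 < (2 : ℝ) ^ ((m : ℝ) / 2) := by positivity
  field_simp

theorem chiMeasure_apply {B : Set ℝ} (hB : MeasurableSet B) :
    chiMeasure m B = ∫⁻ r in Set.Ioi (0 : ℝ), B.indicator 1 r *
      ENNReal.ofReal (chiDensity m r) := by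
  rw [chiMeasure, restrict_Ioi_eq_restrict_Ici, withDensity_apply _ hB, ← lintegral_indicator hB]
  refine lintegral_congr fun r => ?_
  by_cases hr : r ∈ B <;> simp [hr]

instance : SFinite (chiMeasure m) := by
  unfold chiMeasure
  infer_instance

theorem isProbabilityMeasure_sphereUniform (hm : 1 ≤ m) :
    IsProbabilityMeasure (sphereUniform m) := by
  have : Nonempty (Fin m) := ⟨⟨0, hm⟩⟩
  exact ⟨by
    rw [sphereUniform, Measure.smul_apply, smul_eq_mul]
    exact ENNReal.inv_mul_cancel (Measure.measure_univ_ne_zero.2 (Measure.toSphere_ne_zero _))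
      (measure_ne_top _ _)⟩

/-- Spherical-radial decomposition of the standard Gaussian distribution. -/
theorem stdGaussian_apply_eq_lintegral_chiMeasure (hm : 1 ≤ m)
    {A : Set (EuclideanSpace ℝ (Fin m))} (hA : MeasurableSet A) :
    stdGaussian (EuclideanSpace ℝ (Fin m)) A =
      ∫⁻ v : UnitSphere m, chiMeasure m {r : ℝ | r • (v : EuclideanSpace ℝ (Fin m)) ∈ A}
        ∂sphereUniform m := by
  have : Nonempty (Fin m) := ⟨⟨0, hm⟩⟩
  set σ := (volume : Measure (EuclideanSpace ℝ (Fin m))).toSphere with hσ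
  have hσ0 : σ Set.univ ≠ 0 := Measure.measure_univ_ne_zero.2 (Measure.toSphere_ne_zero _)
  have hσt : σ Set.univ ≠ ⊤ := measure_ne_top _ _
  set c : ℝ := ((2 * Real.pi) ^ ((m : ℝ) / 2))⁻¹ with hc
  have hc0 : 0 < c := by positivity
  set k : ℝ := (2 : ℝ) ^ (1 - (m : ℝ) / 2) / Real.Gamma ((m : ℝ) / 2) with hk
  have hk0 : 0 ≤ k := div_nonneg (by positivity) (Real.Gamma_nonneg_of_nonneg (by positivity))
  have hck : (σ Set.univ)⁻¹ * ENNReal.ofReal k = ENNReal.ofReal c := by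
    rw [← toSphere_univ_mul_gaussianConst hm, ← mul_assoc, ENNReal.inv_mul_cancel hσ0 hσt, one_mul]
  have hdm : Measurable fun x : EuclideanSpace ℝ (Fin m) =>
      ENNReal.ofReal (c * Real.exp (-‖x‖ ^ 2 / 2)) := by fun_prop
  rw [stdGaussian_eq_withDensity, withDensity_apply _ hA, ← lintegral_indicator hA,
    lintegral_eq_lintegral_toSphere volume (hdm.indicator hA), sphereUniform, lintegral_smul_measure,
    smul_eq_mul, ← lintegral_const_mul' _ _ (ENNReal.inv_ne_top.2 hσ0)]
  refine lintegral_congr fun v => ?_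
  have hB : MeasurableSet {r : ℝ | r • (v : EuclideanSpace ℝ (Fin m)) ∈ A} :=
    (show Measurable fun r : ℝ => r • (v : EuclideanSpace ℝ (Fin m)) by fun_prop) hA
  rw [chiMeasure_apply hB, ← lintegral_const_mul' _ _ (ENNReal.inv_ne_top.2 hσ0)]
  refine setLIntegral_congr_fun measurableSet_Ioi fun r hr => ?_
  have hr : 0 < r := hr
  have hv : ‖(v : EuclideanSpace ℝ (Fin m))‖ = 1 := norm_eq_of_mem_sphere v
  by_cases hrA : r • (v : EuclideanSpace ℝ (Fin m)) ∈ A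
  · have h1 : r ∈ {r : ℝ | r • (v : EuclideanSpace ℝ (Fin m)) ∈ A} := hrA
    simp only [Set.indicator_of_mem hrA, Set.indicator_of_mem h1, Pi.one_apply, one_mul,
      norm_smul, hv, mul_one, Real.norm_eq_abs, sq_abs, finrank_euclideanSpace_fin, chiDensity]
    rw [← hk, mul_assoc k, ENNReal.ofReal_mul hk0, ← mul_assoc, hck, ENNReal.ofReal_mul hc0.le,
      ENNReal.ofReal_mul (by positivity)]
    ring
  · have h1 : r ∉ {r : ℝ | r • (v : EuclideanSpace ℝ (Fin m)) ∈ A} := hrA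
    simp [Set.indicator_of_notMem hrA, Set.indicator_of_notMem h1]

/-- Applied to the whole space, the decomposition averages the total Chi-mass, which does not depend
on the direction, and the result is `1`. -/
theorem isProbabilityMeasure_chiMeasure (hm : 1 ≤ m) : IsProbabilityMeasure (chiMeasure m) := by
  have := isProbabilityMeasure_sphereUniform hm
  have h := stdGaussian_apply_eq_lintegral_chiMeasure hm MeasurableSet.univ
  simp only [measure_univ, Set.mem_univ, Set.ofPred_true, lintegral_const, mul_one] at h
  exact ⟨h.symm⟩

theorem chiMeasure_Iio_zero : chiMeasure m (Set.Iio 0) = 0 := by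
  refine withDensity_absolutelyContinuous _ _ ?_
  rw [Measure.restrict_apply measurableSet_Iio]
  simp [Set.Iio_inter_Ici]

end Gaussian

/-! ### Spherical-radial form of the probability function -/

section ProbabilityFunction

open ProbabilityTheory

variable {X : Type*} {m : ℕ} {g : X → EuclideanSpace ℝ (Fin m) → ℝ}
  {L : Matrix (Fin m) (Fin m) ℝ} {x : X}

theorem measurable_radialProb (hg : Continuous (g x)) :
    Measurable fun v : UnitSphere m => radialProb g L x v := by
  have hc : Continuous fun p : UnitSphere m × ℝ =>
      g x (p.2 • euclOp L (p.1 : EuclideanSpace ℝ (Fin m))) := hg.comp (by fun_prop)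
  have hs : MeasurableSet {p : UnitSphere m × ℝ | 0 ≤ p.2 ∧
      g x (p.2 • euclOp L (p.1 : EuclideanSpace ℝ (Fin m))) ≤ 0} :=
    (measurableSet_le measurable_const measurable_snd).inter
      (measurableSet_le hc.measurable measurable_const)
  exact (measurable_measure_prodMk_left hs).ennreal_toReal

theorem integrable_radialProb (hm : 1 ≤ m) (hg : Continuous (g x)) :
    Integrable (fun v : UnitSphere m => radialProb g L x v) (sphereUniform m) := by
  have := isProbabilityMeasure_sphereUniform hm
  have := isProbabilityMeasure_chiMeasure hm
  refine Integrable.of_bound (measurable_radialProb hg).aestronglyMeasurable 1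
    (ae_of_all _ fun v => ?_)
  rw [radialProb, Real.norm_of_nonneg ENNReal.toReal_nonneg]
  exact measureReal_le_one

/-- Spherical-radial decomposition of the probability function. -/
theorem probFun_eq_integral_radialProb (hm : 1 ≤ m) (hR : (L * L.transpose).PosSemidef)
    {Ω : Type*} [MeasurableSpace Ω] {P : Measure Ω} {ξ : Ω → EuclideanSpace ℝ (Fin m)}
    (hξ : HasLaw ξ (multivariateGaussian 0 (L * L.transpose)) P) (hg : Continuous (g x)) :
    probFun P ξ g x = ∫ v, radialProb g L x v ∂sphereUniform m := by
  have hC : MeasurableSet {z | g x z ≤ 0} := (isClosed_le hg continuous_const).measurableSet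
  have hA : MeasurableSet {z | g x (euclOp L z) ≤ 0} := (euclOp L).continuous.measurable hC
  have := isProbabilityMeasure_sphereUniform hm
  have := isProbabilityMeasure_chiMeasure hm
  have h1 : P {ω | g x (ξ ω) ≤ 0} =
      stdGaussian (EuclideanSpace ℝ (Fin m)) {z | g x (euclOp L z) ≤ 0} := by
    have h2 : P {ω | g x (ξ ω) ≤ 0} = P.map ξ {z | g x z ≤ 0} :=
      (Measure.map_apply_of_aemeasurable hξ.aemeasurable hC).symm
    rw [h2, hξ.map_eq, multivariateGaussian_eq_map L hR,
      Measure.map_apply (euclOp L).continuous.measurable hC]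
    rfl
  have h3 : ∀ v : UnitSphere m, chiMeasure m {r : ℝ | r • (v : EuclideanSpace ℝ (Fin m)) ∈
      {z | g x (euclOp L z) ≤ 0}} = chiMeasure m {r : ℝ | 0 ≤ r ∧
        g x (r • euclOp L (v : EuclideanSpace ℝ (Fin m))) ≤ 0} := by
    intro v
    refine measure_congr ?_
    -- The Chi-distribution does not charge negative radii, so the restriction `0 ≤ r` is harmless.
    have h0 : ∀ᵐ r ∂chiMeasure m, 0 ≤ r := by
      rw [ae_iff]
      simp only [not_le]
      exact chiMeasure_Iio_zero
    filter_upwards [h0] with r hr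
    refine propext ?_
    change g x (euclOp L (r • (v : EuclideanSpace ℝ (Fin m)))) ≤ 0 ↔ 0 ≤ r ∧ _
    simp [hr]
  rw [probFun, h1, stdGaussian_apply_eq_lintegral_chiMeasure hm hA]
  simp_rw [h3]
  rw [← integral_toReal]
  · rfl
  · have := (measurable_radialProb (L := L) hg).ennreal_ofReal.aemeasurable (μ := sphereUniform m)
    refine this.congr (ae_of_all _ fun v => ?_)
    exact ENNReal.ofReal_toReal (measure_ne_top _ _)
  · exact ae_of_all _ fun v => measure_lt_top _ _

end ProbabilityFunction

/-! ### Estimates for the Chi-distribution -/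

section Chi

variable {m : ℕ}

/-- The normalizing constant of the Chi-density. -/
noncomputable def chiConst (m : ℕ) : ℝ := (2 : ℝ) ^ (1 - (m : ℝ) / 2) / Real.Gamma ((m : ℝ) / 2)

theorem chiConst_pos (hm : 1 ≤ m) : 0 < chiConst m := by
  have hm0 : (0 : ℝ) < m := by exact_mod_cast hm
  exact div_pos (by positivity) (Real.Gamma_pos_of_pos (by positivity))

theorem chiDensity_eq (t : ℝ) :
    chiDensity m t = chiConst m * t ^ (m - 1) * Real.exp (-t ^ 2 / 2) := rfl

theorem chiDensity_pos (hm : 1 ≤ m) {t : ℝ} (ht : 0 < t) : 0 < chiDensity m t := by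
  rw [chiDensity_eq]
  have := chiConst_pos hm
  positivity

/-- From `t^(m-1) ≤ (m-1)! exp t`, the remaining exponent is `t - t²/2 = 1/2 - (t-1)²/2`. -/
theorem exists_chiDensity_le (hm : 1 ≤ m) : ∃ D, 0 ≤ D ∧ ∀ t, 0 ≤ t → chiDensity m t ≤ D := by
  have hk := chiConst_pos hm
  refine ⟨chiConst m * ((m - 1).factorial * Real.exp (1 / 2)), by positivity, fun t ht => ?_⟩
  rw [chiDensity_eq, mul_assoc]
  have h1 : t ^ (m - 1) ≤ (m - 1).factorial * Real.exp t := by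
    have := Real.pow_div_factorial_le_exp t ht (m - 1)
    rwa [div_le_iff₀' (by positivity)] at this
  refine mul_le_mul_of_nonneg_left ?_ hk.le
  calc t ^ (m - 1) * Real.exp (-t ^ 2 / 2)
      ≤ (m - 1).factorial * Real.exp t * Real.exp (-t ^ 2 / 2) := by gcongr
    _ = (m - 1).factorial * Real.exp (t + -t ^ 2 / 2) := by rw [mul_assoc, Real.exp_add]
    _ ≤ (m - 1).factorial * Real.exp (1 / 2) := by
        gcongr
        nlinarith [sq_nonneg (t - 1)]

/-- Exponential decay of the Chi-density. -/
theorem chiDensity_le_mul_exp (hm : 1 ≤ m) {ρ r : ℝ} (hρ : 0 < ρ) (hρm : 2 * (m : ℝ) ≤ ρ ^ 2)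
    (hr : ρ ≤ r) : chiDensity m r ≤ chiDensity m ρ * Real.exp (-(ρ / 2) * (r - ρ)) := by
  have hk := chiConst_pos hm
  set s := r - ρ with hs
  have hs0 : 0 ≤ s := sub_nonneg.2 hr
  have hrs : r = ρ + s := by simp [hs]
  -- The power grows by at most `(1 + s/ρ)^(m-1) ≤ exp((m-1)s/ρ)`, and `2m ≤ ρ²` makes this at most
  -- `exp(ρs/2)`: half of the Gaussian decay `exp(-ρs)` survives.
  have h1 : r ^ (m - 1) ≤ ρ ^ (m - 1) * Real.exp (ρ / 2 * s) := by
    have h2 : r = ρ * (s / ρ + 1) := by rw [hrs]; field_simp; ring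
    have h3 : r ≤ ρ * Real.exp (s / ρ) := by
      rw [h2]
      exact mul_le_mul_of_nonneg_left (Real.add_one_le_exp _) hρ.le
    calc r ^ (m - 1) ≤ (ρ * Real.exp (s / ρ)) ^ (m - 1) :=
          pow_le_pow_left₀ (hρ.le.trans hr) h3 _
      _ = ρ ^ (m - 1) * Real.exp (((m - 1 : ℕ) : ℝ) * (s / ρ)) := by
          rw [mul_pow, ← Real.exp_nat_mul]
      _ ≤ ρ ^ (m - 1) * Real.exp (ρ / 2 * s) := by
          refine mul_le_mul_of_nonneg_left (Real.exp_le_exp.2 ?_) (by positivity)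
          have h4 : ((m - 1 : ℕ) : ℝ) ≤ m := by exact_mod_cast Nat.sub_le m 1
          have h5 : (m : ℝ) ≤ ρ / 2 * ρ := by nlinarith
          calc ((m - 1 : ℕ) : ℝ) * (s / ρ) ≤ (ρ / 2 * ρ) * (s / ρ) := by
                gcongr
                exact h4.trans h5
            _ = ρ / 2 * s := by field_simp
  rw [chiDensity_eq, chiDensity_eq]
  calc chiConst m * r ^ (m - 1) * Real.exp (-r ^ 2 / 2)
      ≤ chiConst m * (ρ ^ (m - 1) * Real.exp (ρ / 2 * s)) * Real.exp (-r ^ 2 / 2) := by gcongr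
    _ = chiConst m * ρ ^ (m - 1) * Real.exp (ρ / 2 * s + -r ^ 2 / 2) := by
        rw [Real.exp_add]; ring
    _ ≤ chiConst m * ρ ^ (m - 1) * Real.exp (-ρ ^ 2 / 2 + -(ρ / 2) * s) := by
        refine mul_le_mul_of_nonneg_left (Real.exp_le_exp.2 ?_) (by positivity)
        rw [hrs]
        nlinarith [sq_nonneg s]
    _ = _ := by rw [Real.exp_add]; ring

theorem chiDensity_le_of_le (hm : 1 ≤ m) {ρ r : ℝ} (hρ : 0 < ρ) (hρm : 2 * (m : ℝ) ≤ ρ ^ 2)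
    (hr : ρ ≤ r) : chiDensity m r ≤ chiDensity m ρ := by
  refine (chiDensity_le_mul_exp hm hρ hρm hr).trans
    (mul_le_of_le_one_right (chiDensity_pos hm hρ).le (Real.exp_le_one_iff.2 ?_))
  have := mul_nonneg hρ.le (sub_nonneg.2 hr)
  linarith

/-- The Chi-density varies by a bounded factor on `[ρ, ρ + 1 / ρ]`. -/
theorem chiDensity_le_exp_mul (hm : 1 ≤ m) {ρ r : ℝ} (hρ : 1 ≤ ρ) (h1 : ρ ≤ r)
    (h2 : r ≤ ρ + 1 / ρ) : chiDensity m ρ ≤ Real.exp (3 / 2) * chiDensity m r := by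
  have hk := chiConst_pos hm
  have hρ0 : 0 < ρ := by linarith
  have hr0 : 0 < r := hρ0.trans_le h1
  have h3 : r ^ 2 ≤ ρ ^ 2 + 3 := by
    have h4 : r ^ 2 ≤ (ρ + 1 / ρ) ^ 2 := pow_le_pow_left₀ (hρ0.le.trans h1) h2 2
    have h5 : (ρ + 1 / ρ) ^ 2 = ρ ^ 2 + 2 + (1 / ρ) ^ 2 := by field_simp; ring
    have h6 : (1 / ρ) ^ 2 ≤ 1 := by
      rw [div_pow, one_pow]
      exact div_le_one_of_le₀ (by nlinarith) (by positivity)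
    linarith
  rw [chiDensity_eq, chiDensity_eq]
  calc chiConst m * ρ ^ (m - 1) * Real.exp (-ρ ^ 2 / 2)
      ≤ chiConst m * r ^ (m - 1) * Real.exp (3 / 2 + -r ^ 2 / 2) := by
        gcongr
        linarith
    _ = _ := by rw [Real.exp_add]; ring

theorem chiMeasure_le_of_subset_Ioc {s : Set ℝ} {a b D : ℝ} (ha : 0 ≤ a) (hs : s ⊆ Set.Ioc a b)
    (hD : ∀ r ∈ Set.Ioc a b, chiDensity m r ≤ D) :
    chiMeasure m s ≤ ENNReal.ofReal (D * (b - a)) := by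
  refine (measure_mono hs).trans ?_
  rw [chiMeasure, withDensity_apply _ measurableSet_Ioc, Measure.restrict_restrict measurableSet_Ioc,
    Set.inter_eq_left.2 fun r hr => Set.mem_Ici.2 (ha.trans hr.1.le)]
  rcases le_or_gt b a with hab | hab
  · simp [Set.Ioc_eq_empty_of_le hab]
  · calc ∫⁻ r in Set.Ioc a b, ENNReal.ofReal (chiDensity m r)
        ≤ ∫⁻ _ in Set.Ioc a b, ENNReal.ofReal D :=
          setLIntegral_mono measurable_const fun r hr => ENNReal.ofReal_le_ofReal (hD r hr)
      _ = ENNReal.ofReal (D * (b - a)) := by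
          rw [setLIntegral_const, Real.volume_Ioc, ENNReal.ofReal_mul' (sub_nonneg.2 hab.le)]

/-- Tail bound for the Chi-distribution. -/
theorem chiMeasure_Ioi_le (hm : 1 ≤ m) {ρ : ℝ} (hρ : 0 < ρ) (hρm : 2 * (m : ℝ) ≤ ρ ^ 2) :
    chiMeasure m (Set.Ioi ρ) ≤ ENNReal.ofReal (2 * (chiDensity m ρ / ρ)) := by
  have hd := chiDensity_pos hm hρ
  have hneg : -(ρ / 2) < 0 := by linarith
  rw [chiMeasure, withDensity_apply _ measurableSet_Ioi, Measure.restrict_restrict measurableSet_Ioi,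
    Set.inter_eq_left.2 fun r hr => Set.mem_Ici.2 (hρ.le.trans (Set.mem_Ioi.1 hr).le)]
  set C := chiDensity m ρ * Real.exp (ρ / 2 * ρ) with hC
  have hle : ∀ r ∈ Set.Ioi ρ, ENNReal.ofReal (chiDensity m r) ≤
      ENNReal.ofReal (C * Real.exp (-(ρ / 2) * r)) := by
    intro r hr
    refine ENNReal.ofReal_le_ofReal
      ((chiDensity_le_mul_exp hm hρ hρm (Set.mem_Ioi.1 hr).le).trans_eq ?_)
    rw [hC, mul_assoc, ← Real.exp_add]
    ring_nf
  refine (setLIntegral_mono (by fun_prop) hle).trans ?_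
  rw [← ofReal_integral_eq_lintegral_ofReal ((integrableOn_exp_mul_Ioi hneg ρ).const_mul C)
    (ae_of_all _ fun r => by positivity), integral_const_mul, integral_exp_mul_Ioi hneg]
  refine ENNReal.ofReal_le_ofReal (le_of_eq ?_)
  rw [hC, mul_assoc, mul_div_assoc', mul_neg, ← Real.exp_add]
  have : ρ / 2 * ρ + -(ρ / 2) * ρ = 0 := by ring
  rw [this, Real.exp_zero]
  field_simp

/-- The Chi-measure of an interval starting at `ρ` whose points satisfy the growth bounds obtained
from convexity is bounded uniformly in `ρ`. -/
theorem exists_chiMeasure_le_mul (hm : 1 ≤ m) {T : ℝ} (hT : 1 ≤ T) (hTm : 2 * (m : ℝ) ≤ T ^ 2)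
    {N : ℝ} (hN : 0 ≤ N) :
    ∃ K : NNReal, ∀ (Δ ρ : ℝ) (I : Set ℝ), 0 ≤ Δ → 0 < ρ → I ⊆ Set.Ioi ρ →
      (∀ r ∈ I, ∀ r', ρ < r' → r' ≤ r → r' ∈ I) →
      (∀ r ∈ I, r ≤ T + 1 → r - ρ ≤ ρ * (N * Δ)) →
      (∀ r ∈ I, T ≤ r → (r - ρ) * chiDensity m r ≤ N * Δ) →
      chiMeasure m I ≤ ENNReal.ofReal (K * Δ) := by
  have := isProbabilityMeasure_chiMeasure hm
  obtain ⟨D, hD0, hD⟩ := exists_chiDensity_le hm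
  have hK0 : 0 ≤ N * (D * T + T + 2 * Real.exp (3 / 2)) := by positivity
  refine ⟨⟨N * (D * T + T + 2 * Real.exp (3 / 2)), hK0⟩, fun Δ ρ I hΔ hρ hI hconn h1 h2 => ?_⟩
  have hNΔ : 0 ≤ N * Δ := mul_nonneg hN hΔ
  have hK : ∀ q : ℝ, q ≤ D * T + T + 2 * Real.exp (3 / 2) → N * Δ * q ≤
      N * (D * T + T + 2 * Real.exp (3 / 2)) * Δ := fun q hq => by
    calc N * Δ * q ≤ N * Δ * (D * T + T + 2 * Real.exp (3 / 2)) := by gcongr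
      _ = _ := by ring
  have hDT : 0 ≤ D * T := by positivity
  have he : 0 < Real.exp (3 / 2) := Real.exp_pos _
  rcases le_or_gt ρ T with hρT | hρT
  · by_cases hex : ∃ r ∈ I, T + 1 < r
    -- An interval passing `T + 1` has already covered length at least `1`, so `1 ≤ T N Δ` and the
    -- trivial bound by the total mass is enough.
    · obtain ⟨r, hr, hrT⟩ := hex
      have h3 := h1 (T + 1) (hconn r hr _ (by linarith) hrT.le) le_rfl
      have h4 : ρ * (N * Δ) ≤ T * (N * Δ) := by gcongr
      refine prob_le_one.trans ?_
      rw [ENNReal.one_le_ofReal]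
      refine le_trans ?_ (hK T (by linarith))
      linarith
    · push Not at hex
      have h3 : I ⊆ Set.Ioc ρ (ρ + T * (N * Δ)) := fun r hr => by
        refine ⟨hI hr, ?_⟩
        have h4 := h1 r hr (hex r hr)
        have h5 : ρ * (N * Δ) ≤ T * (N * Δ) := by gcongr
        linarith
      refine (chiMeasure_le_of_subset_Ioc hρ.le h3
        fun r hr => hD r (hρ.le.trans hr.1.le)).trans (ENNReal.ofReal_le_ofReal ?_)
      refine le_trans (le_of_eq ?_) (hK (D * T) (by linarith))
      ring
  · have hρ1 : 1 ≤ ρ := hT.trans hρT.le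
    have hρm : 2 * (m : ℝ) ≤ ρ ^ 2 := hTm.trans (by gcongr)
    have hdρ := chiDensity_pos hm hρ
    by_cases hex : ∃ r ∈ I, ρ + 1 / ρ ≤ r
    -- At `ρ + 1/ρ` the growth bound controls `χ(ρ)/ρ`, with `χ` the density, and this is the order
    -- of the whole tail beyond `ρ`.
    · obtain ⟨r, hr, hrρ⟩ := hex
      have hpos : 0 < 1 / ρ := by positivity
      have h3 := h2 (ρ + 1 / ρ) (hconn r hr _ (by linarith) hrρ) (by linarith)
      have h4 := chiDensity_le_exp_mul hm hρ1 (r := ρ + 1 / ρ) (by linarith) le_rfl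
      refine (measure_mono hI).trans ((chiMeasure_Ioi_le hm hρ hρm).trans
        (ENNReal.ofReal_le_ofReal ?_))
      refine le_trans ?_ (hK (2 * Real.exp (3 / 2)) (by linarith))
      rw [add_sub_cancel_left] at h3
      calc 2 * (chiDensity m ρ / ρ)
          ≤ 2 * (Real.exp (3 / 2) * chiDensity m (ρ + 1 / ρ) / ρ) := by gcongr
        _ = 2 * Real.exp (3 / 2) * (1 / ρ * chiDensity m (ρ + 1 / ρ)) := by ring
        _ ≤ 2 * Real.exp (3 / 2) * (N * Δ) := by gcongr
        _ = _ := by ring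
    · push Not at hex
      -- Within `1/ρ` of `ρ` the density is comparable to `χ(ρ)`, so `I` has length of order
      -- `NΔ/χ(ρ)`; multiplying by the density cancels `χ(ρ)`.
      have h3 : I ⊆ Set.Ioc ρ (ρ + Real.exp (3 / 2) * (N * Δ) / chiDensity m ρ) := fun r hr => by
        have hρr : ρ < r := hI hr
        refine ⟨hρr, ?_⟩
        have h4 := chiDensity_le_exp_mul hm hρ1 hρr.le (hex r hr).le
        have h5 := h2 r hr (by linarith)
        rw [← sub_le_iff_le_add', le_div_iff₀ hdρ]
        calc (r - ρ) * chiDensity m ρ ≤ (r - ρ) * (Real.exp (3 / 2) * chiDensity m r) := by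
              gcongr
          _ = Real.exp (3 / 2) * ((r - ρ) * chiDensity m r) := by ring
          _ ≤ _ := by gcongr
      refine (chiMeasure_le_of_subset_Ioc hρ.le h3
        fun r hr => chiDensity_le_of_le hm hρ hρm hr.1.le).trans (ENNReal.ofReal_le_ofReal ?_)
      refine le_trans (le_of_eq ?_) (hK (Real.exp (3 / 2)) (by linarith))
      rw [add_sub_cancel_left]
      field_simp

/-- Lipschitz estimate for the Chi-measure of sublevel sets of convex functions on the half-line. -/
theorem exists_chiMeasure_sublevel_le (hm : 1 ≤ m) {T : ℝ} (hT : 1 ≤ T)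
    (hTm : 2 * (m : ℝ) ≤ T ^ 2) {c M₀ M₁ : ℝ} (hc : 0 < c) (hM₀ : 0 ≤ M₀) (hM₁ : 0 ≤ M₁) :
    ∃ K : NNReal, ∀ (Δ : ℝ) (G₁ G₂ : ℝ → ℝ), 0 ≤ Δ → Continuous G₁ →
      ConvexOn ℝ Set.univ G₁ → ConvexOn ℝ Set.univ G₂ → G₁ 0 ≤ -c → G₂ 0 ≤ -c →
      (∀ r, 0 ≤ r → r ≤ T + 1 → G₁ r - G₂ r ≤ M₀ * Δ) →
      (∀ r, T ≤ r → G₂ r ≤ 0 → G₁ r - G₂ r ≤ M₁ * (r ^ m)⁻¹ * Real.exp (r ^ 2 / 2) * Δ) →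
      (chiMeasure m {r | 0 ≤ r ∧ G₂ r ≤ 0}).toReal ≤
        (chiMeasure m {r | 0 ≤ r ∧ G₁ r ≤ 0}).toReal + K * Δ := by
  have := isProbabilityMeasure_chiMeasure hm
  have hk := chiConst_pos hm
  obtain ⟨K, hK⟩ := exists_chiMeasure_le_mul hm hT hTm
    (N := (M₀ + M₁ * chiConst m) / c) (by positivity)
  refine ⟨K, fun Δ G₁ G₂ hΔ hcont hconv₁ hconv₂ h₁ h₂ hsmall hlarge => ?_⟩
  have hneg : ∀ {G : ℝ → ℝ}, ConvexOn ℝ Set.univ G → G 0 ≤ -c → ∀ {s r}, 0 ≤ s → s ≤ r →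
      G r ≤ 0 → G s ≤ 0 := by
    intro G hG h0 s r hs hsr hr
    have := hG.le_max_of_mem_Icc (Set.mem_univ 0) (Set.mem_univ r) ⟨hs, hsr⟩
    exact this.trans (max_le (by linarith) hr)
  by_cases hall : ∀ r, 0 ≤ r → G₁ r ≤ 0
  · have hsub : {r | 0 ≤ r ∧ G₂ r ≤ 0} ⊆ {r | 0 ≤ r ∧ G₁ r ≤ 0} := fun r hr => ⟨hr.1, hall r hr.1⟩
    have h3 := ENNReal.toReal_mono (measure_ne_top _ _) (measure_mono (μ := chiMeasure m) hsub)
    have : 0 ≤ K * Δ := by positivity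
    linarith
  · push Not at hall
    obtain ⟨r₁, hr₁, hGr₁⟩ := hall
    obtain ⟨ρ, hρmem, hρ⟩ := intermediate_value_Icc hr₁ hcont.continuousOn
      (show (0 : ℝ) ∈ Set.Icc (G₁ 0) (G₁ r₁) from ⟨by linarith, hGr₁.le⟩)
    have hρ0 : 0 < ρ := by
      rcases hρmem.1.eq_or_lt with h | h
      · rw [← h] at hρ
        linarith
      · exact h
    set I : Set ℝ := {r | ρ < r ∧ G₂ r ≤ 0} with hIdef
    -- Convexity of `G₁` at `0 < ρ < r` with `G₁ ρ = 0` and `G₁ 0 ≤ -c` gives `c (r - ρ) ≤ ρ G₁ r`;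
    -- subtracting `ρ G₂ r ≤ 0` only enlarges the right side.
    have hkey : ∀ r ∈ I, c * (r - ρ) ≤ ρ * (G₁ r - G₂ r) := by
      rintro r ⟨hr, hGr⟩
      have hr0 : 0 < r := hρ0.trans hr
      have h3 := hconv₁.2 (Set.mem_univ (0 : ℝ)) (Set.mem_univ r)
        (sub_nonneg.2 (div_le_one_of_le₀ hr.le hr0.le))
        (show 0 ≤ ρ / r by positivity) (sub_add_cancel _ _)
      simp only [smul_eq_mul, mul_zero, zero_add, div_mul_cancel₀ _ hr0.ne', hρ] at h3
      have h4 : (1 - ρ / r) * G₁ 0 ≤ (1 - ρ / r) * (-c) :=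
        mul_le_mul_of_nonneg_left h₁ (sub_nonneg.2 (div_le_one_of_le₀ hr.le hr0.le))
      have h5 : 0 ≤ r * ((1 - ρ / r) * (-c) + ρ / r * G₁ r) := mul_nonneg hr0.le (by linarith)
      have h6 : r * ((1 - ρ / r) * (-c) + ρ / r * G₁ r) = -(c * (r - ρ)) + ρ * G₁ r := by
        field_simp
      have h7 : ρ * G₂ r ≤ 0 := mul_nonpos_of_nonneg_of_nonpos hρ0.le hGr
      linarith
    have hIle := hK Δ ρ I hΔ hρ0 (fun r hr => hr.1)
      (fun r hr r' h3 h4 => ⟨h3, hneg hconv₂ h₂ (hρ0.le.trans h3.le) h4 hr.2⟩)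
      (fun r hr hrT => by
        have h3 := hkey r hr
        have h4 := hsmall r (hρ0.le.trans hr.1.le) hrT
        have h5 : ρ * (G₁ r - G₂ r) ≤ ρ * ((M₀ + M₁ * chiConst m) * Δ) := by
          gcongr
          refine h4.trans ?_
          gcongr
          exact le_add_of_nonneg_right (by positivity)
        have h6 : ρ * ((M₀ + M₁ * chiConst m) / c * Δ) =
          ρ * ((M₀ + M₁ * chiConst m) * Δ) / c := by ring
        rw [h6, le_div_iff₀' hc]
        linarith)
      (fun r hr hrT => by
        have hr0 : 0 < r := hρ0.trans hr.1
        have h3 := hkey r hr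
        have h4 := hlarge r hrT hr.2
        have hd := chiDensity_pos hm hr0
        -- The exponentials cancel and the powers leave `1/r`, which compensates the factor `ρ < r`
        -- from `hkey`.
        have h5 : M₁ * (r ^ m)⁻¹ * Real.exp (r ^ 2 / 2) * Δ * chiDensity m r =
            M₁ * chiConst m * Δ / r := by
          rw [chiDensity_eq]
          have h6 : Real.exp (r ^ 2 / 2) * Real.exp (-r ^ 2 / 2) = 1 := by
            rw [← Real.exp_add, ← Real.exp_zero]
            ring_nf
          have h7 : r ^ m = r ^ (m - 1) * r := by rw [← pow_succ, Nat.sub_add_cancel hm]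
          rw [h7]
          calc _ = M₁ * (r ^ (m - 1) * r)⁻¹ * Δ * chiConst m * r ^ (m - 1) *
                (Real.exp (r ^ 2 / 2) * Real.exp (-r ^ 2 / 2)) := by ring
            _ = _ := by
              rw [h6]
              field_simp
        have h8 : c * ((r - ρ) * chiDensity m r) ≤ (M₀ + M₁ * chiConst m) * Δ := by
          calc c * ((r - ρ) * chiDensity m r) = c * (r - ρ) * chiDensity m r := by ring
            _ ≤ ρ * (G₁ r - G₂ r) * chiDensity m r := by gcongr
            _ = ρ * ((G₁ r - G₂ r) * chiDensity m r) := by ring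
            _ ≤ ρ * (M₁ * chiConst m * Δ / r) := by
                rw [← h5]
                gcongr
            _ = (ρ / r) * (M₁ * chiConst m * Δ) := by ring
            _ ≤ 1 * (M₁ * chiConst m * Δ) := by
                gcongr
                exact div_le_one_of_le₀ hr.1.le hr0.le
            _ ≤ (M₀ + M₁ * chiConst m) * Δ := by
                rw [one_mul]
                gcongr
                exact le_add_of_nonneg_left hM₀
        have h9 : (M₀ + M₁ * chiConst m) / c * Δ = (M₀ + M₁ * chiConst m) * Δ / c := by ring
        rw [h9, le_div_iff₀' hc]
        exact h8)
    have hsub : {r | 0 ≤ r ∧ G₂ r ≤ 0} ⊆ {r | 0 ≤ r ∧ G₁ r ≤ 0} ∪ I := by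
      rintro r ⟨hr, hGr⟩
      rcases le_or_gt r ρ with h | h
      · exact Or.inl ⟨hr, hneg hconv₁ h₁ hr h hρ.le⟩
      · exact Or.inr ⟨h, hGr⟩
    have h3 := (measure_mono (μ := chiMeasure m) hsub).trans (measure_union_le _ _)
    have h4 := ENNReal.toReal_mono (by finiteness) (h3.trans (add_le_add_right hIle _))
    rwa [ENNReal.toReal_add (by finiteness) (by finiteness),
      ENNReal.toReal_ofReal (by positivity)] at h4

end Chi

/-! ### Uniform Lipschitz continuity of the radial probabilities -/

/-- Lipschitz continuity in the first variable, uniform over compact sets of the second one. -/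
theorem exists_lipschitzOnWith_of_isCompact {X Y : Type*} [PseudoMetricSpace X]
    [PseudoMetricSpace Y] {g : X → Y → ℝ} (hg : LocallyLipschitz fun p : X × Y => g p.1 p.2)
    (x : X) {C : Set Y} (hC : IsCompact C) :
    ∃ U ∈ 𝓝 x, ∃ K : NNReal, ∀ z ∈ C, LipschitzOnWith K (fun y => g y z) U := by
  refine hC.induction_on (p := fun s => ∃ U ∈ 𝓝 x, ∃ K : NNReal, ∀ z ∈ s,
    LipschitzOnWith K (fun y => g y z) U) ⟨Set.univ, univ_mem, 0, by simp⟩ ?_ ?_ ?_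
  · rintro s t hst ⟨U, hU, K, hK⟩
    exact ⟨U, hU, K, fun z hz => hK z (hst hz)⟩
  · rintro s t ⟨U, hU, K, hK⟩ ⟨U', hU', K', hK'⟩
    refine ⟨U ∩ U', inter_mem hU hU', max K K', fun z hz => ?_⟩
    rcases hz with hz | hz
    · exact ((hK z hz).mono Set.inter_subset_left).weaken (le_max_left _ _)
    · exact ((hK' z hz).mono Set.inter_subset_right).weaken (le_max_right _ _)
  · intro z _
    obtain ⟨K, t, ht, hK⟩ := hg (x, z)
    obtain ⟨U, hU, V, hV, hUV⟩ := mem_nhds_prod_iff.1 ht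
    refine ⟨V, mem_nhdsWithin_of_mem_nhds hV, U, hU, K, fun z' hz' => ?_⟩
    refine LipschitzOnWith.of_dist_le_mul fun y₁ h₁ y₂ h₂ => ?_
    have := hK.dist_le_mul (y₁, z') (hUV ⟨h₁, hz'⟩) (y₂, z') (hUV ⟨h₂, hz'⟩)
    rwa [Prod.dist_eq, dist_self, max_eq_left dist_nonneg] at this

/-- If a convex function family has a bounded sublevel set at `x`, negative at the origin near `x`,
its sublevel sets are uniformly bounded near `x`. -/
theorem eventually_pos_of_isBounded_sublevel {X E : Type*} [TopologicalSpace X]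
    [NormedAddCommGroup E] [NormedSpace ℝ E] [ProperSpace E] {g : X → E → ℝ}
    (hg : Continuous fun p : X × E => g p.1 p.2) (hconv : ∀ y, ConvexOn ℝ Set.univ (g y)) {x : X}
    (hx : g x 0 < 0) (hb : Bornology.IsBounded {z | g x z ≤ 0}) :
    ∃ ρ : ℝ, ∀ᶠ y in 𝓝 x, ∀ z, ρ ≤ ‖z‖ → 0 < g y z := by
  obtain ⟨ρ, hρ0, hρ⟩ := hb.subset_ball_lt 0 (0 : E)
  have h1 : ∀ᶠ y in 𝓝 x, g y 0 < 0 :=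
    (show Continuous fun y => g y 0 from hg.comp (f := fun y => (y, 0)) (by fun_prop)).continuousAt.eventually_lt
      continuousAt_const hx
  -- Positivity on a compact sphere persists near `x`; with negativity at the origin, convexity
  -- propagates it outward along rays.
  have h2 : ∀ᶠ y in 𝓝 x, ∀ z ∈ Metric.sphere (0 : E) ρ, 0 < g y z := by
    refine (isCompact_sphere (0 : E) ρ).eventually_forall_of_forall_eventually fun z hz => ?_
    refine continuousAt_const.eventually_lt hg.continuousAt (not_le.1 fun hle => ?_)
    have := hρ (show z ∈ {z | g x z ≤ 0} from hle)
    rw [mem_ball_zero_iff] at this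
    rw [mem_sphere_zero_iff_norm] at hz
    linarith
  refine ⟨ρ, ?_⟩
  filter_upwards [h1, h2] with y hy1 hy2 z hz
  have hz0 : 0 < ‖z‖ := hρ0.trans_le hz
  have ht : ρ / ‖z‖ ≤ 1 := div_le_one_of_le₀ hz hz0.le
  have h3 := hy2 ((ρ / ‖z‖) • z) (by
    rw [mem_sphere_zero_iff_norm, norm_smul, Real.norm_of_nonneg (by positivity),
      div_mul_cancel₀ _ hz0.ne'])
  have h4 := (hconv y).2 (Set.mem_univ (0 : E)) (Set.mem_univ z) (sub_nonneg.2 ht)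
    (show 0 ≤ ρ / ‖z‖ by positivity) (sub_add_cancel _ _)
  simp only [smul_zero, zero_add, smul_eq_mul] at h4
  by_contra hle
  have h5 := mul_nonpos_of_nonneg_of_nonpos (sub_nonneg.2 ht) hy1.le
  have h6 := mul_nonpos_of_nonneg_of_nonpos (show 0 ≤ ρ / ‖z‖ by positivity) (not_lt.1 hle)
  linarith

section ProbabilityFunction

variable {X : Type*} [NormedAddCommGroup X] [NormedSpace ℝ X] {m : ℕ}
  {g : X → EuclideanSpace ℝ (Fin m) → ℝ} {L : Matrix (Fin m) (Fin m) ℝ} {x : X}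

/-- Nonsingularity of `L` bounds `‖L v‖` below on the sphere, so large radii `r` give uniformly
large points `r L v`, where the growth condition applies. -/
theorem exists_pos_le_norm_euclOp (hR : (L * L.transpose).PosDef) :
    ∃ κ > 0, ∀ v : UnitSphere m, κ ≤ ‖euclOp L (v : EuclideanSpace ℝ (Fin m))‖ := by
  have hdet : IsUnit L := by
    have h := hR.isUnit
    rw [Matrix.isUnit_iff_isUnit_det, Matrix.det_mul] at h
    exact (Matrix.isUnit_iff_isUnit_det _).2 (isUnit_of_mul_isUnit_left h)
  obtain ⟨B, hB⟩ := hdet.exists_left_inv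
  have hinv : ∀ v, euclOp B (euclOp L v) = v := fun v => by
    rw [← mul_apply_eq_comp, ← map_mul, hB, map_one]
    rfl
  have hle : ∀ v : UnitSphere m,
      1 ≤ (‖euclOp B‖ + 1) * ‖euclOp L (v : EuclideanSpace ℝ (Fin m))‖ := fun v => by
    have h1 := (euclOp B).le_opNorm (euclOp L (v : EuclideanSpace ℝ (Fin m)))
    rw [hinv, norm_eq_of_mem_sphere v] at h1
    nlinarith [norm_nonneg (euclOp L (v : EuclideanSpace ℝ (Fin m)))]
  refine ⟨(‖euclOp B‖ + 1)⁻¹, by positivity, fun v => ?_⟩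
  rw [inv_le_iff_one_le_mul₀' (by positivity)]
  exact hle v

/-- Under the growth condition, `g` is Lipschitz along rays with a constant compatible with the
decay of the Chi-density. -/
theorem abs_sub_le_of_niceCone_eq_univ (hgLip : Continuous fun p : X × _ => g p.1 p.2) {l : ℝ}
    (hl : 0 < l) (hcone : niceCone g L l x = Set.univ) {κ : ℝ} (hκ : 0 < κ)
    {v : EuclideanSpace ℝ (Fin m)} (hv : ‖v‖ = 1) (hκv : κ ≤ ‖euclOp L v‖) {r : ℝ}
    (hr0 : 0 < r) (hr : l / κ ≤ r) {y₁ y₂ : X} (h₁ : y₁ ∈ Metric.closedBall x (1 / l))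
    (h₂ : y₂ ∈ Metric.closedBall x (1 / l)) :
    |g y₁ (r • euclOp L v) - g y₂ (r • euclOp L v)| ≤
      l * (κ ^ m)⁻¹ * (r ^ m)⁻¹ * Real.exp (r ^ 2 / 2) * dist y₁ y₂ := by
  set z := r • euclOp L v with hz
  have hnz : ‖z‖ = r * ‖euclOp L v‖ := by rw [hz, norm_smul, Real.norm_of_nonneg hr0.le]
  have hLv : 0 < ‖euclOp L v‖ := hκ.trans_le hκv
  have hLv' : ‖euclOp L v‖ ≤ ‖euclOp L‖ := (euclOp L).unit_le_opNorm v hv.le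
  have hL : 0 < ‖euclOp L‖ := hLv.trans_le hLv'
  have hκz : κ * r ≤ ‖z‖ := by rw [hnz, mul_comm]; gcongr
  have hlz : l ≤ ‖z‖ := by
    rw [div_le_iff₀ hκ, mul_comm] at hr
    exact hr.trans hκz
  have hM0 : 0 ≤ l * (‖z‖ ^ m)⁻¹ * Real.exp (‖z‖ ^ 2 / (2 * ‖euclOp L‖ ^ 2)) := by positivity
  have hLip := lipschitzOnWith_of_clarkeDeriv_le (f := fun y => g y z) (by
      exact hgLip.comp (f := fun y => (y, z)) (by fun_prop)) (convex_closedBall x (1 / l))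
    (M := ⟨_, hM0⟩) (fun y hy h => by
      have hh : h ∈ niceCone g L l x := by rw [hcone]; trivial
      exact hh y hy z hlz)
  have h3 := hLip.dist_le_mul y₁ h₁ y₂ h₂
  rw [Real.dist_eq] at h3
  refine h3.trans (mul_le_mul_of_nonneg_right ?_ dist_nonneg)
  change l * (‖z‖ ^ m)⁻¹ * Real.exp (‖z‖ ^ 2 / (2 * ‖euclOp L‖ ^ 2)) ≤ _
  have h4 : (‖z‖ ^ m)⁻¹ ≤ (κ ^ m)⁻¹ * (r ^ m)⁻¹ := by
    rw [← mul_inv, ← mul_pow]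
    exact inv_anti₀ (by positivity) (pow_le_pow_left₀ (by positivity) hκz m)
  -- As `‖z‖ ≤ r ‖L‖`, the operator norm in the growth condition is what makes its exponential fit
  -- the radial decay.
  have h5 : ‖z‖ ^ 2 / (2 * ‖euclOp L‖ ^ 2) ≤ r ^ 2 / 2 := by
    rw [hnz, mul_pow, div_le_div_iff₀ (by positivity) (by positivity)]
    have : ‖euclOp L v‖ ^ 2 ≤ ‖euclOp L‖ ^ 2 := by gcongr
    calc r ^ 2 * ‖euclOp L v‖ ^ 2 * 2 ≤ r ^ 2 * ‖euclOp L‖ ^ 2 * 2 := by gcongr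
      _ = _ := by ring
  calc l * (‖z‖ ^ m)⁻¹ * Real.exp (‖z‖ ^ 2 / (2 * ‖euclOp L‖ ^ 2))
      ≤ l * ((κ ^ m)⁻¹ * (r ^ m)⁻¹) * Real.exp (r ^ 2 / 2) := by gcongr
    _ = _ := by ring

/-- The radial probability functions are Lipschitz near `x`, uniformly in the direction. -/
theorem exists_lipschitzOnWith_radialProb (hm : 1 ≤ m) (hR : (L * L.transpose).PosDef)
    (hgLip : LocallyLipschitz fun p : X × EuclideanSpace ℝ (Fin m) => g p.1 p.2)
    (hgConv : ∀ y, ConvexOn ℝ Set.univ (g y)) (hx : g x 0 < 0)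
    (hcond : Bornology.IsBounded {z : EuclideanSpace ℝ (Fin m) | g x z ≤ 0} ∨
      ∃ l : ℝ, 0 < l ∧ niceCone g L l x = Set.univ) :
    ∃ U ∈ 𝓝 x, ∃ K : NNReal, ∀ v : UnitSphere m,
      LipschitzOnWith K (fun y => radialProb g L y v) U := by
  have hcont : Continuous fun p : X × EuclideanSpace ℝ (Fin m) => g p.1 p.2 := hgLip.continuous
  obtain ⟨κ, hκ, hκL⟩ := exists_pos_le_norm_euclOp hR
  obtain ⟨T₀, M₁, hM₁, U₁, hU₁, hlarge⟩ : ∃ T₀ M₁ : ℝ, 0 ≤ M₁ ∧ ∃ U₁ ∈ 𝓝 x, ∀ y₁ ∈ U₁, ∀ y₂ ∈ U₁,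
      ∀ v : UnitSphere m, ∀ r, 0 < r → T₀ ≤ r →
        g y₂ (r • euclOp L (v : EuclideanSpace ℝ (Fin m))) ≤ 0 →
        g y₁ (r • euclOp L (v : EuclideanSpace ℝ (Fin m))) -
          g y₂ (r • euclOp L (v : EuclideanSpace ℝ (Fin m))) ≤
            M₁ * (r ^ m)⁻¹ * Real.exp (r ^ 2 / 2) * dist y₁ y₂ := by
    rcases hcond with hb | ⟨l, hl, hcone⟩
    · obtain ⟨ρ, hρ⟩ := eventually_pos_of_isBounded_sublevel hcont hgConv hx hb
      -- For radii from `ρ / κ` on, `g y₂` is positive at `r L v`, so the estimate is vacuous and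
      -- `M₁ = 0` serves.
      refine ⟨ρ / κ, 0, le_rfl, _, hρ, fun y₁ _ y₂ h₂ v r hr hrT hle => ?_⟩
      refine absurd hle (not_le.2 (h₂ _ ?_))
      rw [norm_smul, Real.norm_of_nonneg hr.le]
      calc ρ ≤ r * κ := (div_le_iff₀ hκ).1 hrT
        _ ≤ _ := by
          gcongr
          exact hκL v
    · refine ⟨l / κ, l * (κ ^ m)⁻¹, by positivity, _,
        Metric.closedBall_mem_nhds x (by positivity : 0 < 1 / l),
        fun y₁ h₁ y₂ h₂ v r hr hrT _ => ?_⟩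
      exact (le_abs_self _).trans (abs_sub_le_of_niceCone_eq_univ hcont hl hcone hκ
        (norm_eq_of_mem_sphere v) (hκL v) hr hrT h₁ h₂)
  -- The second entry ensures `1 ≤ T` and `2m ≤ T²`, as the Chi estimates require.
  set T : ℝ := max T₀ (1 + 2 * (m : ℝ)) with hTdef
  have hm0 : (0 : ℝ) ≤ m := Nat.cast_nonneg m
  have hTm : 1 + 2 * (m : ℝ) ≤ T := le_max_right _ _
  have hT1 : 1 ≤ T := by linarith
  obtain ⟨U₂, hU₂, M₀, hM₀⟩ := exists_lipschitzOnWith_of_isCompact hgLip x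
    (isCompact_closedBall (0 : EuclideanSpace ℝ (Fin m)) ((T + 1) * ‖euclOp L‖))
  have hU₃ : ∀ᶠ y in 𝓝 x, g y 0 < g x 0 / 2 :=
    (show Continuous fun y => g y 0 from hcont.comp (f := fun y => (y, 0)) (by fun_prop)).continuousAt.eventually_lt
      continuousAt_const (by linarith)
  obtain ⟨K, hK⟩ := exists_chiMeasure_sublevel_le hm hT1 (by nlinarith)
    (c := -(g x 0 / 2)) (by linarith) M₀.2 hM₁
  have key : ∀ y₁ ∈ U₁ ∩ U₂ ∩ {y | g y 0 < g x 0 / 2}, ∀ y₂ ∈ U₁ ∩ U₂ ∩ {y | g y 0 < g x 0 / 2},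
      ∀ v : UnitSphere m, radialProb g L y₂ v - radialProb g L y₁ v ≤ K * dist y₁ y₂ := by
    rintro y₁ ⟨⟨h₁, h₁'⟩, h₁''⟩ y₂ ⟨⟨h₂, h₂'⟩, h₂''⟩ v
    have hconv : ∀ y, ConvexOn ℝ Set.univ
        fun r : ℝ => g y (r • euclOp L (v : EuclideanSpace ℝ (Fin m))) := fun y => by
      exact (hgConv y).comp_linearMap
        (LinearMap.toSpanSingleton ℝ _ (euclOp L (v : EuclideanSpace ℝ (Fin m))))
    have h0 : ∀ y, g y 0 < g x 0 / 2 →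
        g y ((0 : ℝ) • euclOp L (v : EuclideanSpace ℝ (Fin m))) ≤ - -(g x 0 / 2) := fun y hy => by
      rw [zero_smul, neg_neg]
      exact hy.le
    have := hK (dist y₁ y₂) (fun r => g y₁ (r • euclOp L (v : EuclideanSpace ℝ (Fin m))))
      (fun r => g y₂ (r • euclOp L (v : EuclideanSpace ℝ (Fin m)))) dist_nonneg
      (hcont.comp (f := fun r : ℝ => (y₁, r • euclOp L (v : EuclideanSpace ℝ (Fin m))))
        (by fun_prop)) (hconv y₁) (hconv y₂) (h0 y₁ h₁'') (h0 y₂ h₂'')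
      (fun r hr hrT => by
        refine (le_abs_self _).trans ((hM₀ _ ?_).dist_le_mul y₁ h₁' y₂ h₂')
        rw [mem_closedBall_zero_iff, norm_smul, Real.norm_of_nonneg hr]
        gcongr
        exact (euclOp L).unit_le_opNorm _ (norm_eq_of_mem_sphere v).le)
      (fun r hrT hle => hlarge y₁ h₁ y₂ h₂ v r (by linarith) ((le_max_left _ _).trans hrT) hle)
    exact sub_le_iff_le_add'.2 this
  refine ⟨U₁ ∩ U₂ ∩ {y | g y 0 < g x 0 / 2}, inter_mem (inter_mem hU₁ hU₂) hU₃, K, fun v => ?_⟩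
  refine LipschitzOnWith.of_dist_le_mul fun y₁ h₁ y₂ h₂ => ?_
  rw [Real.dist_eq]
  refine abs_sub_le_iff.2 ⟨?_, key y₁ h₁ y₂ h₂ v⟩
  rw [dist_comm]
  exact key y₂ h₂ y₁ h₁ v

end ProbabilityFunction

theorem mainTheorem8
    {X : Type*} [NormedAddCommGroup X] [NormedSpace ℝ X] [CompleteSpace X]
    [TopologicalSpace.SeparableSpace X] (hX : ReflexiveSpace X)
    {m : ℕ} (hm : 1 ≤ m)
    (R L : Matrix (Fin m) (Fin m) ℝ) (hR : IsCorrelationMatrix R) (hL : R = L * L.transpose)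
    {Ω : Type*} [MeasurableSpace Ω] (P : Measure Ω) [IsProbabilityMeasure P]
    (ξ : Ω → EuclideanSpace ℝ (Fin m))
    (hξ : ProbabilityTheory.HasLaw ξ (ProbabilityTheory.multivariateGaussian 0 R) P)
    (g : X → EuclideanSpace ℝ (Fin m) → ℝ)
    (hgLip : LocallyLipschitz (fun p : X × EuclideanSpace ℝ (Fin m) => g p.1 p.2))
    (hgConv : ∀ x, ConvexOn ℝ Set.univ (g x))
    (x : X) (hx : g x 0 < 0)
    (hcond : Bornology.IsBounded {z : EuclideanSpace ℝ (Fin m) | g x z ≤ 0} ∨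
      ∃ l : ℝ, 0 < l ∧ niceCone g L l x = Set.univ) :
    (∃ K : NNReal, ∃ U ∈ 𝓝 x, LipschitzOnWith K (probFun P ξ g) U) ∧
    clarkeSubdiff (probFun P ξ g) x ⊆
      aumannIntegral (sphereUniform m)
        (fun v => clarkeSubdiff (fun x' => radialProb g L x' v) x) := by
  have hpos : (L * L.transpose).PosDef := hL ▸ hR.posDef
  subst hL
  have := isProbabilityMeasure_sphereUniform hm
  have := hX.separableSpace_dual
  have hcont : ∀ y, Continuous (g y) := fun y =>
    hgLip.continuous.comp (f := fun z => (y, z)) (by fun_prop)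
  obtain ⟨U, hU, K, hK⟩ := exists_lipschitzOnWith_radialProb hm hpos hgLip hgConv hx hcond
  have hi := fun y => integrable_radialProb (L := L) hm (hcont y)
  have hφ := fun y => probFun_eq_integral_radialProb hm hpos.posSemidef hξ (hcont y)
  exact ⟨⟨K, U, hU, lipschitzOnWith_integral _ hK hi hφ⟩,
    clarkeSubdiff_integral_subset _ hU hK (fun y => measurable_radialProb (hcont y)) hi hφ⟩
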